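/- **Setting.** A *static hard star* consists of $B>0$ and continuous functions $r_0,\rho_0,m_0$ on $[0,B]$ (area radius, density, Hawking mass as functions of the particle-number coordinate $\chi$) with $r_0(0)=m_0(0)=0$, $\rho_0(B)=1$, $\rho_0\ge1$ on $[0,B]$, $r_0>0$ and $2m_0<r_0$ on $(0,B]$, which satisfy on $(0,B]$ $$\partial_\chi r_0=\frac{\sqrt{1-2m_0/r_0}}{4\pi r_0^2\sqrt{2\rho_0-1}},\qquad \partial_\chi m_0=4\pi r_0^2\rho_0\,\partial_\chi r_0,\qquad \partial_\chi\rho_0=-\frac{2\rho_0-1}{r_0-2m_0}\Bigl[4\pi r_0^2(\rho_0-1)+\frac{m_0}{r_0}\Bigr]\partial_\chi r_0 .$$ Put $R_0=r_0(B)$, $\psi_0=-\frac12\log(2\rho_0-1)$, $q=\partial_\chi\psi_0/\partial_\chi r_0$ and $G=\frac{m_0}{r_0^2}+4\pi r_0(\rho_0-1)$. A *solution of the linearised system* around the star is a tuple $(r_1,\rho_1,n_1,\psi_1,\omega_1,m_1)$ of real functions of $(\phi,\chi)\in[0,\infty)\times(0,B]$ such that $r_1$ is $C^\infty$ there and satisfies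 $$(2\rho_0-1)\partial_\phi^2r_1-\frac{G}{\partial_\chi\psi_0}\partial_\chi\Bigl(\frac{\partial_\chi r_1}{\partial_\chi r_0}\Bigr)=\Bigl[2qG+\frac{2m_0}{r_0^3}+4\pi r_0(2\rho_0-1)\Bigl(\frac2{r_0}-q\Bigr)\Bigr]r_1+\frac{G}{\partial_\chi\psi_0}\partial_\chi\Bigl[\Bigl(\frac2{r_0}-q\Bigr)r_1\Bigr]+\Bigl(4\pi r_0\rho_0-\frac{m_0}{r_0^2}\Bigr)\frac{\partial_\chi r_1}{\partial_\chi r_0},$$ with $r_1=0$ at $\chi=0$ (in the sense that $r_1$ and all its $\phi$-derivatives extend continuously by $0$ to $\chi=0$), and, for all $\phi\ge0$, $\partial_\chi r_1=\kappa\,\bigl(q-\frac{2}{r_0}\bigr)r_1$ at $\chi=B$, where either $\kappa=\partial_\chi r_0(B)$ (the condition $\psi_1|_{\chi=B}=0$) or $\kappa=1$; and such that $$\rho_1=-\psi_1(2\rho_0-1)=n_1\sqrt{2\rho_0-1},\quad \omega_1=\frac{\partial_\chi r_1}{\partial_\chi r_0}-q\,r_1,\quad \psi_1=\Bigl(\frac2{r_0}-q\Bigr)r_1+\frac{\partial_\chi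 r_1}{\partial_\chi r_0},\quad m_1=-4\pi r_0^2(\rho_0-1)r_1 .$$ For a function $u(\phi,\chi)$ let $\mathcal E[u](\phi)=\int_0^B\bigl[\frac{u^2}{r_0^2}+(\partial_\phi u)^2+r_0^4(\partial_\chi u)^2\bigr]d\chi$, and let $\mathcal E_i(0)=\sum_{j\le i}\mathcal E[\partial_\phi^j r_1](0)$ be the initial energy of order $i$. **Proposition 4.3.** There is $\varepsilon>0$ such that for every small static hard star, i.e. one with $R_0<\varepsilon$ and $\rho_0(0)<1+\varepsilon$, there are constants $0<C_0<C_1<C_2<\cdots$, depending only on the star, such that every solution of the linearised system around it satisfies, for all $i\ge1$, $\mathcal E_i(0)<\infty$ and, for all $\phi\ge0$, $$\int_0^B\sum_{j_1+j_2\le i}r_0^{6j_2-2}\bigl(\partial_\phi^{j_1}\partial_\chi^{j_2}r_1\bigr)^2d\chi\le C_i\,\mathcal E_i(0),$$ $$\int_0^B\sum_{j_1+j_2\le i}r_0^{6j_2}\Bigl[\bigl(\partial_\phi^{j_1}\partial_\chi^{j_2}\psi_1\bigr)^2+\bigl(\partial_\phi^{j_1}\partial_\chi^{j_2}\omega_1\bigr)^2\Bigr]d\chi\le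 C_i\,\mathcal E_i(0).$$ -/

import Mathlib

open Set Filter Topology MeasureTheory
open scoped ENNReal ContDiff

noncomputable section

/-- A static hard star (two-phase model, hard phase, units with critical density one) in the comoving
particle-number coordinate `χ ∈ [0, B]`: area radius `r`, energy density `rho`, Hawking mass `m`.
The pressure is `rho - 1`, the particle density is `n = √(2 rho - 1)`, and `χ` counts particles, so
that `n = √(1 - 2m/r) / (4π r² ∂_χ r)`.  At the centre `χ = 0` the radius behaves like `χ^(1/3)`, so
differential equations are imposed on `(0, B]` (one-sidedly at `B`). -/
structure StaticHardStar where
  /-- total number of particles -/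
  B : ℝ
  /-- area radius -/
  r : ℝ → ℝ
  /-- energy density -/
  rho : ℝ → ℝ
  /-- Hawking mass -/
  m : ℝ → ℝ
  B_pos : 0 < B
  continuousOn_r : ContinuousOn r (Icc 0 B)
  continuousOn_rho : ContinuousOn rho (Icc 0 B)
  continuousOn_m : ContinuousOn m (Icc 0 B)
  r_zero : r 0 = 0
  m_zero : m 0 = 0
  /-- the pressure vanishes on the boundary of the star -/
  rho_B : rho B = 1
  r_pos : ∀ χ ∈ Ioc 0 B, 0 < r χ
  /-- hard phase -/
  one_le_rho : ∀ χ ∈ Icc 0 B, 1 ≤ rho χ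
  /-- no trapped shells -/
  two_m_lt_r : ∀ χ ∈ Ioc 0 B, 2 * m χ < r χ
  /-- `χ` is the particle-number coordinate -/
  hasDeriv_r : ∀ χ ∈ Ioc 0 B, HasDerivWithinAt r
    (√(1 - 2 * m χ / r χ) / (4 * Real.pi * r χ ^ 2 * √(2 * rho χ - 1))) (Ioc 0 B) χ
  /-- the mass equation `∂_χ m = 4π r² rho ∂_χ r` -/
  hasDeriv_m : ∀ χ ∈ Ioc 0 B, HasDerivWithinAt m
    (4 * Real.pi * r χ ^ 2 * rho χ * derivWithin r (Ioc 0 B) χ) (Ioc 0 B) χ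
  /-- the Tolman-Oppenheimer-Volkoff equation -/
  hasDeriv_rho : ∀ χ ∈ Ioc 0 B, HasDerivWithinAt rho
    (-((2 * rho χ - 1) / (r χ - 2 * m χ))
        * (4 * Real.pi * r χ ^ 2 * (rho χ - 1) + m χ / r χ) * derivWithin r (Ioc 0 B) χ)
    (Ioc 0 B) χ

namespace StaticHardStar

/-- The radius of the boundary of the star. -/
def radius (S : StaticHardStar) : ℝ := S.r S.B

/-- The metric function `ψ₀`, determined by `2 rho - 1 = exp (-2 ψ₀)`. -/
def psi (S : StaticHardStar) (χ : ℝ) : ℝ := -(1 / 2) * Real.log (2 * S.rho χ - 1)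

/-- `∂_χ` of a function of `χ ∈ (0, B]` (one-sided at `χ = B`). -/
def dχ (S : StaticHardStar) (f : ℝ → ℝ) (χ : ℝ) : ℝ := derivWithin f (Ioc 0 S.B) χ

/-- The quotient `∂_χ ψ₀ / ∂_χ r₀`. -/
def q (S : StaticHardStar) (χ : ℝ) : ℝ := S.dχ S.psi χ / S.dχ S.r χ

/-- The quantity `m₀ / r₀² + 4π r₀ (rho₀ - 1)`. -/
def G (S : StaticHardStar) (χ : ℝ) : ℝ :=
  S.m χ / S.r χ ^ 2 + 4 * Real.pi * S.r χ * (S.rho χ - 1)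

/-- The space-time domain `φ ≥ 0`, `0 < χ ≤ B` (the interior of the star without its centre). -/
def domain (S : StaticHardStar) : Set (ℝ × ℝ) := Ici 0 ×ˢ Ioc 0 S.B

/-- `∂_χ` of a function of `(φ, χ)` with `φ ≥ 0`, `χ ∈ (0, B]`. -/
def pχ (S : StaticHardStar) (u : ℝ → ℝ → ℝ) : ℝ → ℝ → ℝ := fun φ χ => S.dχ (u φ) χ

end StaticHardStar

/-- `∂_φ` of a function of `(φ, χ)` with `φ ≥ 0` (one-sided at `φ = 0`). -/
def pφ (u : ℝ → ℝ → ℝ) : ℝ → ℝ → ℝ := fun φ χ => derivWithin (fun s => u s χ) (Ici 0) φ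

namespace StaticHardStar

/-- The mixed partial derivative `∂_φ^{j₁} ∂_χ^{j₂} u`. -/
def partials (S : StaticHardStar) (j₁ j₂ : ℕ) (u : ℝ → ℝ → ℝ) : ℝ → ℝ → ℝ :=
  pφ^[j₁] (S.pχ^[j₂] u)

/-- The decoupled wave equation satisfied by the linearised radius, at the point `(φ, χ)`. -/
def MasterEquation (S : StaticHardStar) (r₁ : ℝ → ℝ → ℝ) (φ χ : ℝ) : Prop :=
  (2 * S.rho χ - 1) * pφ (pφ r₁) φ χ
      - S.G χ * (1 / S.dχ S.psi χ) * S.dχ (fun x => S.pχ r₁ φ x / S.dχ S.r x) χ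
    = (2 * S.q χ * S.G χ + 2 * (S.m χ / S.r χ ^ 3)
          + 4 * Real.pi * S.r χ * (2 * S.rho χ - 1) * (2 / S.r χ - S.q χ)) * r₁ φ χ
      + S.G χ * (1 / S.dχ S.psi χ) * S.dχ (fun x => (2 / S.r x - S.q x) * r₁ φ x) χ
      + (4 * Real.pi * S.r χ * S.rho χ - S.m χ / S.r χ ^ 2) * (S.pχ r₁ φ χ / S.dχ S.r χ)

/-- `(r₁, rho₁, n₁, psi₁, omega₁, m₁)` is a (smooth) solution, for `φ ≥ 0`, of the spherically
symmetric Einstein-Euler equations linearised around the star `S` in comoving coordinates with fixed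
particle number. -/
structure IsLinearisedSolution (S : StaticHardStar)
    (r₁ rho₁ n₁ psi₁ omega₁ m₁ : ℝ → ℝ → ℝ) : Prop where
  /-- smooth away from the centre, up to `φ = 0` and up to the boundary `χ = B` -/
  smooth : ContDiffOn ℝ ∞ (fun p : ℝ × ℝ => r₁ p.1 p.2) S.domain
  wave : ∀ φ : ℝ, 0 ≤ φ → ∀ χ ∈ Ioc 0 S.B, S.MasterEquation r₁ φ χ
  /-- `r₁ = 0` at the centre: `r₁` and its `φ`-derivatives extend continuously by zero to `χ = 0` -/
  centre : ∀ (j : ℕ) (φ : ℝ), 0 ≤ φ →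
    Tendsto (fun p : ℝ × ℝ => (pφ^[j] r₁) p.1 p.2) (𝓝[S.domain] (φ, 0)) (𝓝 0)
  /-- The condition at `χ = B`. The second alternative is the condition `psi₁ = 0` (vanishing
  pressure); the first one is the variant of it without the factor `∂_χ r₀`. -/
  boundary :
    (∀ φ : ℝ, 0 ≤ φ → S.pχ r₁ φ S.B = (S.q S.B - 2 / S.r S.B) * r₁ φ S.B) ∨
    (∀ φ : ℝ, 0 ≤ φ → S.pχ r₁ φ S.B = S.dχ S.r S.B * (S.q S.B - 2 / S.r S.B) * r₁ φ S.B)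
  rho_psi : ∀ φ : ℝ, 0 ≤ φ → ∀ χ ∈ Ioc 0 S.B, rho₁ φ χ = -psi₁ φ χ * (2 * S.rho χ - 1)
  rho_n : ∀ φ : ℝ, 0 ≤ φ → ∀ χ ∈ Ioc 0 S.B, rho₁ φ χ = n₁ φ χ * √(2 * S.rho χ - 1)
  omega_eq : ∀ φ : ℝ, 0 ≤ φ → ∀ χ ∈ Ioc 0 S.B,
    omega₁ φ χ = S.pχ r₁ φ χ / S.dχ S.r χ - S.q χ * r₁ φ χ
  psi_eq : ∀ φ : ℝ, 0 ≤ φ → ∀ χ ∈ Ioc 0 S.B,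
    psi₁ φ χ = (2 / S.r χ - S.q χ) * r₁ φ χ + S.pχ r₁ φ χ / S.dχ S.r χ
  m_eq : ∀ φ : ℝ, 0 ≤ φ → ∀ χ ∈ Ioc 0 S.B,
    m₁ φ χ = -4 * Real.pi * S.r χ ^ 2 * (S.rho χ - 1) * r₁ φ χ

/-- The energy `𝓔[u](φ) = ∫₀ᴮ u²/r₀² + (∂_φ u)² + r₀⁴ (∂_χ u)² dχ`, with values in `[0, ∞]`. -/
def energy (S : StaticHardStar) (u : ℝ → ℝ → ℝ) (φ : ℝ) : ℝ≥0∞ :=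
  ∫⁻ χ in Ioc 0 S.B, ENNReal.ofReal
    (u φ χ ^ 2 / S.r χ ^ 2 + pφ u φ χ ^ 2 + S.r χ ^ 4 * S.pχ u φ χ ^ 2)

/-- The initial energy of order `i`: the sum over `j ≤ i` of the initial values of the energies of
`∂_φ^j u`. -/
def initialEnergy (S : StaticHardStar) (i : ℕ) (u : ℝ → ℝ → ℝ) : ℝ≥0∞ :=
  ∑ j ∈ Finset.range (i + 1), S.energy (pφ^[j] u) 0

/-- The pairs `(j₁, j₂)` of natural numbers with `j₁ + j₂ ≤ i`. -/
def orders (i : ℕ) : Finset (ℕ × ℕ) :=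
  (Finset.range (i + 1) ×ˢ Finset.range (i + 1)).filter (fun j => j.1 + j.2 ≤ i)

/-- `∫₀ᴮ ∑_{j₁+j₂≤i} r₀^(6j₂-2) (∂_φ^{j₁} ∂_χ^{j₂} r₁)² dχ`. -/
def radiusEnergy (S : StaticHardStar) (i : ℕ) (r₁ : ℝ → ℝ → ℝ) (φ : ℝ) : ℝ≥0∞ :=
  ∫⁻ χ in Ioc 0 S.B, ENNReal.ofReal
    (∑ j ∈ orders i, S.r χ ^ (6 * (j.2 : ℤ) - 2) * S.partials j.1 j.2 r₁ φ χ ^ 2)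

/-- `∫₀ᴮ ∑_{j₁+j₂≤i} r₀^(6j₂) [(∂_φ^{j₁} ∂_χ^{j₂} psi₁)² + (∂_φ^{j₁} ∂_χ^{j₂} omega₁)²] dχ`. -/
def metricEnergy (S : StaticHardStar) (i : ℕ) (psi₁ omega₁ : ℝ → ℝ → ℝ) (φ : ℝ) : ℝ≥0∞ :=
  ∫⁻ χ in Ioc 0 S.B, ENNReal.ofReal
    (∑ j ∈ orders i, S.r χ ^ (6 * j.2) *
      (S.partials j.1 j.2 psi₁ φ χ ^ 2 + S.partials j.1 j.2 omega₁ φ χ ^ 2))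

end StaticHardStar

end

/-! Write D = ∂_χ / ∂_χ r₀, p = 2/r₀ - q and `lin` u = Du + pu. Structural identities of the star
turn the equation for r₁ into n²∂_φ²u = c D(`lin` u) + h `lin` u + V u, with c = 1 - 2m₀/r₀ and Dc =
-2h. Both boundary conditions become `lin` u = θpu at χ = B with 0 ≤ θ ≤ 1
(`IsLinearisedSolution.isWave`), so they are treated together.

Multiplying by 2∂_φu/c gives a conservation law (`IsSmall.pφ_conserved`) for (n²/c)(∂_φu)² + (`lin`
u)² - (V/c)u². Its flux at B is θ∂_φN, where N = (p/∂_χ r₀)u² ≥ 0. Expanding (`lin` u)² shows that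
the conserved density minus ∂_χN dominates the energy density: the coefficient of u² is 2/r₀² plus
bounded terms, and r₀ is small (`IsSmall.coercive_coeff`, `IsSmall.density_add_le`). Since θ ≤ 1,
the boundary terms N(B) have the favourable sign, and the energy at any time is bounded by a fixed
multiple of the initial energy (`IsWave.energy_le`).

The centre needs care, because only continuity of the φ-derivatives is assumed there. The equation
is integrated from B inwards to bound `lin` u, then the identity defining `lin` is integrated from
the centre outwards to get |u| ≤ K r₀ (`IsWave.linear_bound`). Hence energies are finite and the
contributions of the inner end vanish in the limit.

All coefficients are independent of φ, so every ∂_φ^l u obeys the same estimate. For χ-derivatives,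
r₀³∂_χ maps u and r₀ `lin` u to combinations of u, r₀ `lin` u and r₀²∂_φ²u, with coefficients that
stay bounded under further r₀³∂_χ. Each r₀³∂_χ thus costs one order of energy
(`IsControlled.scaled_deriv`), which yields the weights r₀^(6j₂). -/

noncomputable section

/-! ### The background star: equations for its coefficients and monotonicity bounds. -/

namespace StaticHardStar

variable (S : StaticHardStar)

/-- The average density `m₀ / r₀³` up to a factor. -/
def mu (χ : ℝ) : ℝ := S.m χ / S.r χ ^ 3

/-- The metric coefficient `1 - 2 m₀ / r₀`, written so that it is regular at the centre. -/
def c (χ : ℝ) : ℝ := 1 - 2 * S.mu χ * S.r χ ^ 2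

/-- The particle density. -/
def n (χ : ℝ) : ℝ := √(2 * S.rho χ - 1)

/-- The quantity `r₀² ∂_χ r₀`. -/
def s (χ : ℝ) : ℝ := √(S.c χ) / (4 * Real.pi * S.n χ)

/-- The coefficient `2 / r₀ - q`. -/
def p (χ : ℝ) : ℝ := 2 / S.r χ - S.q χ

/-- The quantity `4π r₀ rho₀ - m₀ / r₀²`. -/
def h (χ : ℝ) : ℝ := 4 * Real.pi * S.r χ * S.rho χ - S.m χ / S.r χ ^ 2

/-- The potential of the linearised equation in divergence form. -/
def V (χ : ℝ) : ℝ := S.q χ * S.G χ + 2 * S.G χ / S.r χ + 2 * S.mu χ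

variable {S} {χ : ℝ}

lemma Ioc_sub : Ioc 0 S.B ⊆ Icc 0 S.B := Ioc_subset_Icc_self

lemma r_ne (hχ : χ ∈ Ioc 0 S.B) : S.r χ ≠ 0 := (S.r_pos χ hχ).ne'

lemma one_le_rho' (hχ : χ ∈ Ioc 0 S.B) : 1 ≤ S.rho χ := S.one_le_rho χ (Ioc_sub hχ)

lemma m_eq (hχ : χ ∈ Ioc 0 S.B) : S.m χ = S.mu χ * S.r χ ^ 3 := by
  have := r_ne hχ
  unfold mu; field_simp

lemma c_eq (hχ : χ ∈ Ioc 0 S.B) : S.c χ = 1 - 2 * S.m χ / S.r χ := by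
  have := r_ne hχ
  unfold c mu; field_simp

lemma c_pos (hχ : χ ∈ Ioc 0 S.B) : 0 < S.c χ := by
  have h1 := S.two_m_lt_r χ hχ
  have h2 := S.r_pos χ hχ
  rw [c_eq hχ, sub_pos, div_lt_one h2]; exact h1

lemma n_pos (hχ : χ ∈ Ioc 0 S.B) : 0 < S.n χ := by
  have := one_le_rho' hχ
  exact Real.sqrt_pos.2 (by linarith)

lemma n_sq (hχ : χ ∈ Ioc 0 S.B) : S.n χ ^ 2 = 2 * S.rho χ - 1 := by
  have := one_le_rho' hχ
  exact Real.sq_sqrt (by linarith)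

lemma s_pos (hχ : χ ∈ Ioc 0 S.B) : 0 < S.s χ := by
  have := n_pos hχ
  have := Real.sqrt_pos.2 (c_pos hχ)
  have := Real.pi_pos
  unfold s; positivity

lemma uniqueDiff (hχ : χ ∈ Ioc 0 S.B) : UniqueDiffWithinAt ℝ (Ioc 0 S.B) χ :=
  uniqueDiffOn_Ioc 0 S.B χ hχ

lemma hasDerivWithinAt_r (hχ : χ ∈ Ioc 0 S.B) :
    HasDerivWithinAt S.r (S.s χ / S.r χ ^ 2) (Ioc 0 S.B) χ := by
  convert S.hasDeriv_r χ hχ using 1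
  have := r_ne hχ
  have := (n_pos hχ).ne'
  have := Real.pi_pos.ne'
  rw [s, ← c_eq hχ, n]
  rw [n] at *
  field_simp

lemma dχ_r (hχ : χ ∈ Ioc 0 S.B) : S.dχ S.r χ = S.s χ / S.r χ ^ 2 :=
  (hasDerivWithinAt_r hχ).derivWithin (uniqueDiff hχ)

lemma hasDerivWithinAt_m (hχ : χ ∈ Ioc 0 S.B) :
    HasDerivWithinAt S.m (4 * Real.pi * S.rho χ * S.s χ) (Ioc 0 S.B) χ := by
  convert S.hasDeriv_m χ hχ using 1
  have := r_ne hχ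
  have h2 := dχ_r hχ
  rw [dχ] at h2
  rw [h2]; field_simp

lemma G_eq (hχ : χ ∈ Ioc 0 S.B) :
    S.G χ = S.r χ * (S.mu χ + 4 * Real.pi * (S.rho χ - 1)) := by
  have := r_ne hχ
  unfold G mu; field_simp

lemma hasDerivWithinAt_rho (hχ : χ ∈ Ioc 0 S.B) :
    HasDerivWithinAt S.rho (-(S.n χ ^ 2 * (S.G χ / S.c χ)) * (S.s χ / S.r χ ^ 2))
      (Ioc 0 S.B) χ := by
  convert S.hasDeriv_rho χ hχ using 1
  have h0 := r_ne hχ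
  have h2 := dχ_r hχ
  rw [dχ] at h2
  have h3 : S.r χ - 2 * S.m χ ≠ 0 := by have := S.two_m_lt_r χ hχ; linarith
  have h4 : S.c χ = (S.r χ - 2 * S.m χ) / S.r χ := by rw [c_eq hχ]; field_simp
  rw [h2, n_sq hχ, h4]
  unfold G
  field_simp
  ring

lemma hasDerivWithinAt_psi (hχ : χ ∈ Ioc 0 S.B) :
    HasDerivWithinAt S.psi (S.G χ / S.c χ * (S.s χ / S.r χ ^ 2)) (Ioc 0 S.B) χ := by
  have h1 := one_le_rho' hχ
  have h2 : 2 * S.rho χ - 1 ≠ 0 := by linarith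
  have := ((((hasDerivWithinAt_rho hχ).const_mul 2).sub_const 1).log h2).const_mul (-(1 / 2))
  refine this.congr_deriv ?_
  rw [n_sq hχ]
  have := r_ne hχ
  have := (c_pos hχ).ne'
  field_simp

lemma dχ_psi (hχ : χ ∈ Ioc 0 S.B) :
    S.dχ S.psi χ = S.G χ / S.c χ * (S.s χ / S.r χ ^ 2) :=
  (hasDerivWithinAt_psi hχ).derivWithin (uniqueDiff hχ)

lemma q_eq (hχ : χ ∈ Ioc 0 S.B) : S.q χ = S.G χ / S.c χ := by
  have := r_ne hχ
  have := (s_pos hχ).ne'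
  have := (c_pos hχ).ne'
  rw [q, dχ_psi hχ, dχ_r hχ]
  field_simp

lemma hasDerivWithinAt_mu (hχ : χ ∈ Ioc 0 S.B) :
    HasDerivWithinAt S.mu (S.s χ / S.r χ ^ 3 * (4 * Real.pi * S.rho χ - 3 * S.mu χ))
      (Ioc 0 S.B) χ := by
  have h0 := r_ne hχ
  have := (hasDerivWithinAt_m hχ).div ((hasDerivWithinAt_r hχ).pow 3) (pow_ne_zero 3 h0)
  refine this.congr_deriv ?_
  simp only [mu, Pi.pow_apply]
  field_simp
  push_cast
  ring

lemma hasDerivWithinAt_c (hχ : χ ∈ Ioc 0 S.B) :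
    HasDerivWithinAt S.c (-2 * S.h χ * (S.s χ / S.r χ ^ 2)) (Ioc 0 S.B) χ := by
  have h0 := r_ne hχ
  have := (((hasDerivWithinAt_mu hχ).const_mul 2).mul
    ((hasDerivWithinAt_r hχ).pow 2)).const_sub 1
  refine this.congr_deriv ?_
  simp only [h, m_eq hχ, Pi.pow_apply]
  field_simp
  ring

lemma hasDerivWithinAt_n (hχ : χ ∈ Ioc 0 S.B) :
    HasDerivWithinAt S.n (-(S.n χ * S.q χ) * (S.s χ / S.r χ ^ 2)) (Ioc 0 S.B) χ := by
  have h1 := one_le_rho' hχ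
  have h2 : 2 * S.rho χ - 1 ≠ 0 := by linarith
  have h3 := n_pos hχ
  have := (((hasDerivWithinAt_rho hχ).const_mul 2).sub_const 1).sqrt h2
  refine this.congr_deriv ?_
  rw [q_eq hχ, ← n]
  have := r_ne hχ
  have := (c_pos hχ).ne'
  field_simp

lemma Ioo_sub : Ioo 0 S.B ⊆ Ioc 0 S.B := Ioo_subset_Ioc_self

/-- A function which is continuous on `[0, B]` with nonnegative derivative on `(0, B)` is
monotone. -/
lemma monotoneOn_Icc {f f' : ℝ → ℝ} (hf : ContinuousOn f (Icc 0 S.B))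
    (hd : ∀ χ ∈ Ioc 0 S.B, HasDerivWithinAt f (f' χ) (Ioc 0 S.B) χ)
    (h0 : ∀ χ ∈ Ioc 0 S.B, 0 ≤ f' χ) : MonotoneOn f (Icc 0 S.B) := by
  refine monotoneOn_of_hasDerivWithinAt_nonneg (f' := f') (convex_Icc _ _) hf ?_ ?_
  · rw [interior_Icc]
    exact fun x hx => (hd x (Ioo_sub hx)).mono Ioo_sub
  · rw [interior_Icc]
    exact fun x hx => h0 x (Ioo_sub hx)

lemma left_mem : (0 : ℝ) ∈ Icc 0 S.B := left_mem_Icc.2 S.B_pos.le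

lemma right_mem : S.B ∈ Ioc 0 S.B := right_mem_Ioc.2 S.B_pos

lemma r_le_radius (hχ : χ ∈ Ioc 0 S.B) : S.r χ ≤ S.radius := by
  have hm := monotoneOn_Icc S.continuousOn_r (fun χ hχ => hasDerivWithinAt_r hχ)
    (fun χ hχ => by have := s_pos hχ; have := S.r_pos χ hχ; positivity)
  exact hm (Ioc_sub hχ) (Ioc_sub right_mem) hχ.2

/-- As rho ≥ 1, the excess of m over the mass of a ball of density one is nondecreasing in χ and
vanishes at the centre. -/
lemma mu_ge (hχ : χ ∈ Ioc 0 S.B) : 4 * Real.pi / 3 ≤ S.mu χ := by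
  have hm := monotoneOn_Icc (f := fun χ => S.m χ - 4 * Real.pi / 3 * S.r χ ^ 3)
    (S.continuousOn_m.sub ((S.continuousOn_r.pow 3).const_mul _))
    (fun χ hχ => (hasDerivWithinAt_m hχ).sub (((hasDerivWithinAt_r hχ).pow 3).const_mul _))
    (fun χ hχ => by
      have := s_pos hχ
      have h1 := one_le_rho' hχ
      have := r_ne hχ
      have e : 4 * Real.pi * S.rho χ * S.s χ - 4 * Real.pi / 3 *
          (((3 : ℕ) : ℝ) * S.r χ ^ (3 - 1) * (S.s χ / S.r χ ^ 2))
          = 4 * Real.pi * S.s χ * (S.rho χ - 1) := by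
        push_cast; field_simp
      rw [e]
      have := Real.pi_pos
      have : 0 ≤ S.rho χ - 1 := by linarith
      positivity)
  have := hm left_mem (Ioc_sub hχ) hχ.1.le
  simp only [S.r_zero, S.m_zero] at this
  have hr := S.r_pos χ hχ
  rw [mu, le_div_iff₀ (by positivity)]
  linarith

lemma mu_pos (hχ : χ ∈ Ioc 0 S.B) : 0 < S.mu χ := by
  have := mu_ge hχ
  have := Real.pi_pos
  linarith

/-- This makes the density decrease outwards, and it makes ∂_χ ψ₀ nonzero, so that the quotient G /
∂_χ ψ₀ in the equation can be simplified. -/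
lemma G_pos (hχ : χ ∈ Ioc 0 S.B) : 0 < S.G χ := by
  have h1 := one_le_rho' hχ
  have := mu_pos hχ
  have := Real.pi_pos
  have := S.r_pos χ hχ
  have : 0 ≤ S.rho χ - 1 := by linarith
  rw [G_eq hχ]; positivity

lemma rho_le (hχ : χ ∈ Ioc 0 S.B) : S.rho χ ≤ S.rho 0 := by
  have hm := monotoneOn_Icc (f := fun χ => -S.rho χ) S.continuousOn_rho.neg
    (fun χ hχ => (hasDerivWithinAt_rho hχ).neg)
    (fun χ hχ => by
      have := s_pos hχ
      have := G_pos hχ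
      have := c_pos hχ
      have := S.r_pos χ hχ
      rw [neg_mul, neg_neg]; positivity)
  have := hm left_mem (Ioc_sub hχ) hχ.1.le
  simp only at this
  linarith

/-- Comparison with a ball of the central density, which is the maximal one. -/
lemma mu_le (hχ : χ ∈ Ioc 0 S.B) : S.mu χ ≤ 4 * Real.pi / 3 * S.rho 0 := by
  have hm := monotoneOn_Icc (f := fun χ => 4 * Real.pi / 3 * S.rho 0 * S.r χ ^ 3 - S.m χ)
    (((S.continuousOn_r.pow 3).const_mul _).sub S.continuousOn_m)
    (fun χ hχ => (((hasDerivWithinAt_r hχ).pow 3).const_mul _).sub (hasDerivWithinAt_m hχ))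
    (fun χ hχ => by
      have := s_pos hχ
      have h1 := rho_le hχ
      have := r_ne hχ
      have e : 4 * Real.pi / 3 * S.rho 0 *
          (((3 : ℕ) : ℝ) * S.r χ ^ (3 - 1) * (S.s χ / S.r χ ^ 2)) - 4 * Real.pi * S.rho χ * S.s χ
          = 4 * Real.pi * S.s χ * (S.rho 0 - S.rho χ) := by
        push_cast; field_simp
      rw [e]
      have := Real.pi_pos
      have : 0 ≤ S.rho 0 - S.rho χ := by linarith
      positivity)
  have := hm left_mem (Ioc_sub hχ) hχ.1.le
  simp only [S.r_zero, S.m_zero] at this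
  have hr := S.r_pos χ hχ
  rw [mu, div_le_iff₀ (by positivity)]
  linarith

/-! ### Smallness: explicit bounds for the coefficients. -/

variable (S) in
/-- A star with small radius and small central density excess. -/
structure IsSmall : Prop where
  radius_lt : S.radius < 1 / 100
  rho_lt : S.rho 0 < 1 + 1 / 100

namespace IsSmall

variable (hS : S.IsSmall)
include hS


lemma r_lt (hχ : χ ∈ Ioc 0 S.B) : S.r χ < 1 / 100 :=
  (r_le_radius hχ).trans_lt hS.radius_lt

lemma rho_le_const (hχ : χ ∈ Ioc 0 S.B) : S.rho χ ≤ 101 / 100 := by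
  have := rho_le hχ
  have := hS.rho_lt
  linarith

lemma mu_le_const (hχ : χ ∈ Ioc 0 S.B) : S.mu χ ≤ 17 / 4 := by
  have h1 := mu_le hχ
  have := hS.rho_lt
  have := Real.pi_lt_d2
  have := Real.pi_pos
  nlinarith

/-- The regular quotient `G / r₀` is bounded. -/
lemma G_div_le (hχ : χ ∈ Ioc 0 S.B) : S.mu χ + 4 * Real.pi * (S.rho χ - 1) ≤ 9 / 2 := by
  have h1 := hS.mu_le_const hχ
  have := hS.rho_le_const hχ
  have := one_le_rho' hχ
  have := Real.pi_lt_d2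
  have := Real.pi_pos
  nlinarith

lemma G_le (hχ : χ ∈ Ioc 0 S.B) : S.G χ ≤ 9 / 2 * S.r χ := by
  have h1 := hS.G_div_le hχ
  have := S.r_pos χ hχ
  rw [G_eq hχ]; nlinarith

lemma r_sq_lt (hχ : χ ∈ Ioc 0 S.B) : S.r χ ^ 2 < 1 / 10000 := by
  have h1 := hS.r_lt hχ
  have := S.r_pos χ hχ
  nlinarith

lemma c_ge (hχ : χ ∈ Ioc 0 S.B) : 99 / 100 ≤ S.c χ := by
  have h1 := hS.mu_le_const hχ
  have h2 := mu_pos hχ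
  have := hS.r_sq_lt hχ
  have := sq_nonneg (S.r χ)
  unfold c; nlinarith

omit hS in
lemma c_le (hχ : χ ∈ Ioc 0 S.B) : S.c χ ≤ 1 := by
  have h2 := mu_pos hχ
  have : 0 ≤ S.mu χ * S.r χ ^ 2 := by positivity
  unfold c; linarith

omit hS in
lemma one_le_n (hχ : χ ∈ Ioc 0 S.B) : 1 ≤ S.n χ := by
  have := one_le_rho' hχ
  exact Real.one_le_sqrt.2 (by linarith)

lemma n_sq_le (hχ : χ ∈ Ioc 0 S.B) : S.n χ ^ 2 ≤ 51 / 50 := by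
  have := hS.rho_le_const hχ
  rw [n_sq hχ]; linarith

lemma n_le (hχ : χ ∈ Ioc 0 S.B) : S.n χ ≤ 2 := by
  have := hS.n_sq_le hχ
  nlinarith

omit hS in
lemma q_pos (hχ : χ ∈ Ioc 0 S.B) : 0 < S.q χ := by
  rw [q_eq hχ]; exact div_pos (G_pos hχ) (c_pos hχ)

lemma q_le (hχ : χ ∈ Ioc 0 S.B) : S.q χ ≤ 5 * S.r χ := by
  have h1 := hS.G_le hχ
  have h2 := hS.c_ge hχ
  have := S.r_pos χ hχ
  rw [q_eq hχ, div_le_iff₀ (c_pos hχ)]; nlinarith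

omit hS in
lemma h_eq (hχ : χ ∈ Ioc 0 S.B) : S.h χ = S.r χ * (4 * Real.pi * S.rho χ - S.mu χ) := by
  have := r_ne hχ
  rw [h, m_eq hχ]; field_simp

lemma h_nonneg (hχ : χ ∈ Ioc 0 S.B) : 0 ≤ S.h χ := by
  rw [h_eq hχ]
  have h1 := hS.mu_le_const hχ
  have := one_le_rho' hχ
  have := Real.pi_gt_d2
  have := S.r_pos χ hχ
  have : 0 ≤ 4 * Real.pi * S.rho χ - S.mu χ := by nlinarith
  positivity

lemma h_le (hχ : χ ∈ Ioc 0 S.B) : S.h χ ≤ 13 * S.r χ := by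
  rw [h_eq hχ]
  have h1 := mu_pos hχ
  have := hS.rho_le_const hχ
  have := one_le_rho' hχ
  have := Real.pi_lt_d2
  have := S.r_pos χ hχ
  have : 4 * Real.pi * S.rho χ - S.mu χ ≤ 13 := by nlinarith
  nlinarith

omit hS in
lemma V_nonneg (hχ : χ ∈ Ioc 0 S.B) : 0 ≤ S.V χ := by
  have := q_pos hχ
  have := G_pos hχ
  have := mu_pos hχ
  have := S.r_pos χ hχ
  unfold V; positivity

lemma V_le (hχ : χ ∈ Ioc 0 S.B) : S.V χ ≤ 20 := by
  have h1 := hS.q_le hχ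
  have h2 := q_pos hχ
  have h3 := hS.G_le hχ
  have h4 := G_pos hχ
  have h5 := hS.mu_le_const hχ
  have h6 := S.r_pos χ hχ
  have h7 := hS.r_lt hχ
  have h8 : 2 * S.G χ / S.r χ ≤ 9 := by rw [div_le_iff₀ h6]; linarith
  have h9 : S.q χ * S.G χ ≤ 1 * 1 := by gcongr <;> linarith
  unfold V; linarith

lemma p_pos (hχ : χ ∈ Ioc 0 S.B) : 0 < S.p χ := by
  have h1 := hS.q_le hχ
  have h6 := S.r_pos χ hχ
  have h7 := hS.r_lt hχ
  have : 1 < 2 / S.r χ := by rw [lt_div_iff₀ h6]; linarith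
  unfold p; linarith

omit hS in
lemma p_le (hχ : χ ∈ Ioc 0 S.B) : S.p χ ≤ 2 / S.r χ := by
  have h1 := q_pos hχ
  unfold p; linarith

omit hS in
/-- The derivative of `q` with respect to `χ`. -/
lemma hasDerivWithinAt_q (hχ : χ ∈ Ioc 0 S.B) :
    HasDerivWithinAt S.q
      (((4 * Real.pi * S.rho χ - 2 * S.mu χ + 4 * Real.pi * (S.rho χ - 1)
        - 4 * Real.pi * S.r χ * (S.n χ ^ 2 * S.q χ)) / S.c χ
        + 2 * S.q χ * S.h χ / S.c χ) * (S.s χ / S.r χ ^ 2)) (Ioc 0 S.B) χ := by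
  have hc := (c_pos hχ).ne'
  have hr := r_ne hχ
  have h1 := ((hasDerivWithinAt_r hχ).mul ((hasDerivWithinAt_mu hχ).add
    (((hasDerivWithinAt_rho hχ).sub_const 1).const_mul (4 * Real.pi)))).div
    (hasDerivWithinAt_c hχ) hc
  refine (h1.congr_of_mem (fun x hx => ?_) hχ).congr_deriv ?_
  · rw [q_eq hx, G_eq hx]; rfl
  · simp only [q_eq hχ, Pi.mul_apply, Pi.add_apply, G_eq hχ]
    field_simp
    ring

/-- The zeroth order coefficient of the energy density dominates `1 / r₀²`. -/
lemma coercive_coeff (hχ : χ ∈ Ioc 0 S.B) :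
    1 / S.r χ ^ 2 ≤ 2 / S.r χ ^ 2 + ((4 * Real.pi * S.rho χ - 2 * S.mu χ
        + 4 * Real.pi * (S.rho χ - 1)
        - 4 * Real.pi * S.r χ * (S.n χ ^ 2 * S.q χ)) / S.c χ
        + 2 * S.q χ * S.h χ / S.c χ) - S.p χ * S.h χ / S.c χ - S.V χ / S.c χ := by
  have hr := S.r_pos χ hχ
  have hc := hS.c_ge hχ
  have hc0 := c_pos hχ
  have hm := hS.mu_le_const hχ
  have hV := hS.V_le hχ
  have hh := hS.h_le hχ
  have hh0 := hS.h_nonneg hχ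
  have hp0 := hS.p_pos hχ
  have hq0 := q_pos hχ
  have hr1 := hS.r_lt hχ
  have hpi := Real.pi_lt_d2
  have hpi0 := Real.pi_pos
  have hrho := one_le_rho' hχ
  have h1 : S.p χ * S.h χ ≤ 26 := by
    calc S.p χ * S.h χ ≤ 2 / S.r χ * (13 * S.r χ) := by
          gcongr; exact p_le hχ
      _ = 26 := by field_simp; norm_num
  have h2 : 4 * Real.pi * S.r χ * (S.n χ ^ 2 * S.q χ) ≤ 4 * 4 * 1 * (2 * 1) := by
    gcongr
    · linarith
    · linarith
    · linarith [hS.n_sq_le hχ]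
    · linarith [hS.q_le hχ]
  -- Smallness enters here: one of the two copies of 1 / r₀² absorbs all remaining terms, which are
  -- bounded independently of the star.
  have h3 : 10000 ≤ 1 / S.r χ ^ 2 := by
    rw [le_div_iff₀ (by positivity)]
    linarith [hS.r_sq_lt hχ]
  have h4 : 0 ≤ 2 * S.q χ * S.h χ := by positivity
  have h5 : 0 ≤ 4 * Real.pi * (S.rho χ - 1) := by
    have : 0 ≤ S.rho χ - 1 := by linarith
    positivity
  have h6 : 0 ≤ 4 * Real.pi * S.rho χ := by positivity
  have e : 2 / S.r χ ^ 2 = 1 / S.r χ ^ 2 + 1 / S.r χ ^ 2 := by ring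
  have h7 : -10000 ≤ (4 * Real.pi * S.rho χ - 2 * S.mu χ
        + 4 * Real.pi * (S.rho χ - 1)
        - 4 * Real.pi * S.r χ * (S.n χ ^ 2 * S.q χ) + 2 * S.q χ * S.h χ
        - S.p χ * S.h χ - S.V χ) / S.c χ := by
    rw [le_div_iff₀ hc0]
    linarith
  have h8 : ∀ a b d e : ℝ, a / S.c χ + b / S.c χ - d / S.c χ - e / S.c χ
      = (a + b - d - e) / S.c χ := by intros; ring
  have h9 := h8 (4 * Real.pi * S.rho χ - 2 * S.mu χ + 4 * Real.pi * (S.rho χ - 1)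
        - 4 * Real.pi * S.r χ * (S.n χ ^ 2 * S.q χ)) (2 * S.q χ * S.h χ)
        (S.p χ * S.h χ) (S.V χ)
  linarith

end IsSmall
end StaticHardStar

/-! ### Symbols: coefficients with bounded iterated derivatives under r₀³∂_χ. -/

namespace StaticHardStar

variable (S : StaticHardStar)

/-- Functions on `(0, B]` whose first `k` iterated derivatives with respect to `r₀³ ∂_χ` are
bounded. -/
def IsSymbolOrder : ℕ → (ℝ → ℝ) → Prop
  | 0, f => ∃ K, ∀ χ ∈ Ioc 0 S.B, |f χ| ≤ K
  | k + 1, f => (∃ K, ∀ χ ∈ Ioc 0 S.B, |f χ| ≤ K) ∧ DifferentiableOn ℝ f (Ioc 0 S.B) ∧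
      IsSymbolOrder k (fun χ => S.r χ ^ 3 * S.dχ f χ)

/-- Functions on `(0, B]` all of whose iterated derivatives with respect to `r₀³ ∂_χ` are
bounded. -/
def IsSymbol (f : ℝ → ℝ) : Prop := ∀ k, S.IsSymbolOrder k f

variable {S} {χ : ℝ} {f g : ℝ → ℝ} {k : ℕ}

lemma IsSymbolOrder.bounded (hf : S.IsSymbolOrder k f) : ∃ K, ∀ χ ∈ Ioc 0 S.B, |f χ| ≤ K := by
  cases k with
  | zero => exact hf
  | succ k => exact hf.1

lemma dχ_congr (hfg : ∀ x ∈ Ioc 0 S.B, f x = g x) (hχ : χ ∈ Ioc 0 S.B) :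
    S.dχ f χ = S.dχ g χ :=
  derivWithin_congr hfg (hfg χ hχ)

lemma IsSymbolOrder.congr (hf : S.IsSymbolOrder k f) (hfg : ∀ x ∈ Ioc 0 S.B, g x = f x) :
    S.IsSymbolOrder k g := by
  induction k generalizing f g with
  | zero =>
    obtain ⟨K, hK⟩ := hf
    exact ⟨K, fun χ hχ => by rw [hfg χ hχ]; exact hK χ hχ⟩
  | succ k ih =>
    obtain ⟨⟨K, hK⟩, hd, hY⟩ := hf
    refine ⟨⟨K, fun χ hχ => by rw [hfg χ hχ]; exact hK χ hχ⟩, hd.congr hfg, ih hY fun x hx => ?_⟩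
    rw [dχ_congr hfg hx]

lemma IsSymbolOrder.of_succ (hf : S.IsSymbolOrder (k + 1) f) : S.IsSymbolOrder k f := by
  induction k generalizing f with
  | zero => exact hf.1
  | succ k ih => exact ⟨hf.1, hf.2.1, ih hf.2.2⟩

/-- A bounded function with derivative `r₀⁻³ g` for a symbol `g` is a symbol. -/
lemma IsSymbolOrder.of_hasDeriv (hb : ∃ K, ∀ χ ∈ Ioc 0 S.B, |f χ| ≤ K)
    (hd : ∀ χ ∈ Ioc 0 S.B, HasDerivWithinAt f (g χ / S.r χ ^ 3) (Ioc 0 S.B) χ)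
    (hg : S.IsSymbolOrder k g) : S.IsSymbolOrder (k + 1) f := by
  refine ⟨hb, fun χ hχ => (hd χ hχ).differentiableWithinAt, hg.congr fun χ hχ => ?_⟩
  rw [dχ, (hd χ hχ).derivWithin (uniqueDiff hχ)]
  have := r_ne hχ
  field_simp

lemma IsSymbolOrder.hasDeriv (hf : S.IsSymbolOrder (k + 1) f) (hχ : χ ∈ Ioc 0 S.B) :
    HasDerivWithinAt f ((S.r χ ^ 3 * S.dχ f χ) / S.r χ ^ 3) (Ioc 0 S.B) χ := by
  have := r_ne hχ
  refine (hf.2.1 χ hχ).hasDerivWithinAt.congr_deriv ?_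
  rw [dχ]; field_simp

lemma IsSymbolOrder.const (a : ℝ) : S.IsSymbolOrder k (fun _ => a) := by
  induction k generalizing a with
  | zero => exact ⟨|a|, fun _ _ => le_rfl⟩
  | succ k ih =>
    exact .of_hasDeriv ⟨|a|, fun _ _ => le_rfl⟩
      (fun χ _ => by simpa using hasDerivWithinAt_const χ (Ioc 0 S.B) a) (ih 0)

lemma IsSymbolOrder.add (hf : S.IsSymbolOrder k f) (hg : S.IsSymbolOrder k g) :
    S.IsSymbolOrder k (fun χ => f χ + g χ) := by
  have hb : ∃ K, ∀ χ ∈ Ioc 0 S.B, |f χ + g χ| ≤ K := by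
    obtain ⟨K, hK⟩ := hf.bounded
    obtain ⟨K', hK'⟩ := hg.bounded
    exact ⟨K + K', fun χ hχ => (abs_add_le _ _).trans (add_le_add (hK χ hχ) (hK' χ hχ))⟩
  induction k generalizing f g with
  | zero => exact hb
  | succ k ih =>
    refine .of_hasDeriv hb (fun χ hχ => ?_) (ih hf.2.2 hg.2.2
      ((hf.2.2.bounded).elim fun K hK => (hg.2.2.bounded).elim fun K' hK' =>
        ⟨K + K', fun χ hχ => (abs_add_le _ _).trans (add_le_add (hK χ hχ) (hK' χ hχ))⟩))
    exact ((hf.hasDeriv hχ).add (hg.hasDeriv hχ)).congr_deriv (by ring)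

lemma IsSymbolOrder.mul (hf : S.IsSymbolOrder k f) (hg : S.IsSymbolOrder k g) :
    S.IsSymbolOrder k (fun χ => f χ * g χ) := by
  have hb : ∀ {k : ℕ} {f g : ℝ → ℝ}, S.IsSymbolOrder k f → S.IsSymbolOrder k g →
      ∃ K, ∀ χ ∈ Ioc 0 S.B, |f χ * g χ| ≤ K := by
    intro k f g hf hg
    obtain ⟨K, hK⟩ := hf.bounded
    obtain ⟨K', hK'⟩ := hg.bounded
    refine ⟨K * K', fun χ hχ => ?_⟩
    rw [abs_mul]
    exact mul_le_mul (hK χ hχ) (hK' χ hχ) (abs_nonneg _) ((abs_nonneg _).trans (hK χ hχ))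
  induction k generalizing f g with
  | zero => exact hb hf hg
  | succ k ih =>
    refine .of_hasDeriv (hb hf hg) (fun χ hχ => ?_) ((ih hf.2.2 hg.of_succ).add
      (ih hf.of_succ hg.2.2))
    exact ((hf.hasDeriv hχ).mul (hg.hasDeriv hχ)).congr_deriv (by ring)

lemma IsSymbolOrder.inv {δ : ℝ} (hδ : 0 < δ) (hf : S.IsSymbolOrder k f)
    (h0 : ∀ χ ∈ Ioc 0 S.B, δ ≤ f χ) : S.IsSymbolOrder k (fun χ => (f χ)⁻¹) := by
  have hb : ∃ K, ∀ χ ∈ Ioc 0 S.B, |(f χ)⁻¹| ≤ K := by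
    refine ⟨δ⁻¹, fun χ hχ => ?_⟩
    have := h0 χ hχ
    rw [abs_of_pos (inv_pos.2 (by linarith))]
    gcongr
  induction k with
  | zero => exact hb
  | succ k ih =>
    have h1 := ih hf.of_succ
    refine .of_hasDeriv hb (fun χ hχ => ?_) (((IsSymbolOrder.const (-1)).mul hf.2.2).mul
      (h1.mul h1))
    have := h0 χ hχ
    have h2 : f χ ≠ 0 := by linarith
    exact ((hf.hasDeriv hχ).fun_inv h2).congr_deriv (by field_simp)

lemma IsSymbolOrder.sqrt {δ : ℝ} (hδ : 0 < δ) (hf : S.IsSymbolOrder k f)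
    (h0 : ∀ χ ∈ Ioc 0 S.B, δ ≤ f χ) : S.IsSymbolOrder k (fun χ => √(f χ)) := by
  have hb : ∃ K, ∀ χ ∈ Ioc 0 S.B, |√(f χ)| ≤ K := by
    obtain ⟨K, hK⟩ := hf.bounded
    refine ⟨√K, fun χ hχ => ?_⟩
    rw [abs_of_nonneg (Real.sqrt_nonneg _)]
    exact Real.sqrt_le_sqrt ((le_abs_self _).trans (hK χ hχ))
  induction k with
  | zero => exact hb
  | succ k ih =>
    have h1 := (ih hf.of_succ).inv (Real.sqrt_pos.2 hδ)
      (fun χ hχ => Real.sqrt_le_sqrt (h0 χ hχ))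
    refine .of_hasDeriv hb (fun χ hχ => ?_) (((IsSymbolOrder.const (1 / 2)).mul hf.2.2).mul h1)
    have := h0 χ hχ
    have h2 : f χ ≠ 0 := by linarith
    exact ((hf.hasDeriv hχ).sqrt h2).congr_deriv (by ring)

lemma IsSymbol.const (a : ℝ) : S.IsSymbol (fun _ => a) := fun _ => .const a

lemma IsSymbol.add (hf : S.IsSymbol f) (hg : S.IsSymbol g) : S.IsSymbol (fun χ => f χ + g χ) :=
  fun k => (hf k).add (hg k)

lemma IsSymbol.mul (hf : S.IsSymbol f) (hg : S.IsSymbol g) : S.IsSymbol (fun χ => f χ * g χ) :=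
  fun k => (hf k).mul (hg k)

lemma IsSymbol.neg (hf : S.IsSymbol f) : S.IsSymbol (fun χ => -f χ) :=
  fun k => (((IsSymbolOrder.const (-1)).mul (hf k))).congr fun _ _ => by ring

lemma IsSymbol.inv {δ : ℝ} (hδ : 0 < δ) (hf : S.IsSymbol f)
    (h0 : ∀ χ ∈ Ioc 0 S.B, δ ≤ f χ) : S.IsSymbol (fun χ => (f χ)⁻¹) :=
  fun k => (hf k).inv hδ h0

lemma IsSymbol.congr (hf : S.IsSymbol f) (hfg : ∀ x ∈ Ioc 0 S.B, g x = f x) : S.IsSymbol g :=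
  fun k => (hf k).congr hfg

lemma IsSymbol.scaled_deriv (hf : S.IsSymbol f) : S.IsSymbol (fun χ => S.r χ ^ 3 * S.dχ f χ) :=
  fun k => (hf (k + 1)).2.2

lemma IsSymbol.bounded (hf : S.IsSymbol f) : ∃ K, ∀ χ ∈ Ioc 0 S.B, |f χ| ≤ K :=
  (hf 0).bounded

lemma IsSymbol.hasDeriv (hf : S.IsSymbol f) (hχ : χ ∈ Ioc 0 S.B) :
    HasDerivWithinAt f (S.dχ f χ) (Ioc 0 S.B) χ :=
  ((hf 1).2.1 χ hχ).hasDerivWithinAt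

namespace IsSmall

variable (hS : S.IsSmall)
include hS

lemma isSymbolOrder_s (hr : S.IsSymbolOrder k S.r) (hmu : S.IsSymbolOrder k S.mu)
    (hrho : S.IsSymbolOrder k S.rho) :
    S.IsSymbolOrder k S.c ∧ S.IsSymbolOrder k S.n ∧ S.IsSymbolOrder k S.s := by
  have hc : S.IsSymbolOrder k S.c :=
    ((IsSymbolOrder.const 1).add ((IsSymbolOrder.const (-2)).mul (hmu.mul (hr.mul hr)))).congr
      fun x _ => by unfold c; ring
  have hn : S.IsSymbolOrder k S.n :=
    (((IsSymbolOrder.const 2).mul hrho).add (IsSymbolOrder.const (-1))).sqrt one_pos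
      (fun χ hχ => by linarith [one_le_rho' hχ])
  refine ⟨hc, hn, ?_⟩
  refine (((IsSymbolOrder.const (4 * Real.pi)⁻¹).mul (hn.inv one_pos
    (fun χ hχ => one_le_n hχ))).mul (hc.sqrt (δ := 99 / 100) (by norm_num)
    fun χ hχ => hS.c_ge hχ)).congr fun x _ => ?_
  unfold s
  rw [div_eq_mul_inv, mul_inv]; ring

/-- Since r₀³∂_χ = s r₀ ∂/∂r₀, the structure equations express r₀³∂_χ of r, mu and rho through r,
mu, rho, c⁻¹, n and s without negative powers of r₀. The system is closed, so induction on the order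
treats the three functions simultaneously. -/
lemma isSymbolOrder_base :
    S.IsSymbolOrder k S.r ∧ S.IsSymbolOrder k S.mu ∧ S.IsSymbolOrder k S.rho := by
  have b1 : ∃ K, ∀ χ ∈ Ioc 0 S.B, |S.r χ| ≤ K :=
    ⟨1 / 100, fun χ hχ => by rw [abs_of_pos (S.r_pos χ hχ)]; exact (hS.r_lt hχ).le⟩
  have b2 : ∃ K, ∀ χ ∈ Ioc 0 S.B, |S.mu χ| ≤ K :=
    ⟨17 / 4, fun χ hχ => by rw [abs_of_pos (mu_pos hχ)]; exact hS.mu_le_const hχ⟩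
  have b3 : ∃ K, ∀ χ ∈ Ioc 0 S.B, |S.rho χ| ≤ K :=
    ⟨101 / 100, fun χ hχ => by
      rw [abs_of_pos (by linarith [one_le_rho' hχ])]; exact hS.rho_le_const hχ⟩
  induction k with
  | zero => exact ⟨b1, b2, b3⟩
  | succ k ih =>
    obtain ⟨hr, hmu, hrho⟩ := ih
    obtain ⟨hc, hn, hs⟩ := hS.isSymbolOrder_s hr hmu hrho
    refine ⟨.of_hasDeriv b1 (fun χ hχ => ?_) (hr.mul hs),
      .of_hasDeriv b2 (fun χ hχ => hasDerivWithinAt_mu hχ |>.congr_deriv ?_)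
        (hs.mul (((IsSymbolOrder.const (4 * Real.pi)).mul hrho).add
        ((IsSymbolOrder.const (-3)).mul hmu))),
      .of_hasDeriv b3 (fun χ hχ => hasDerivWithinAt_rho hχ |>.congr_deriv ?_)
        ((IsSymbolOrder.const (-1)).mul ((hn.mul hn).mul
        ((hs.mul (hr.mul hr)).mul ((hmu.add ((IsSymbolOrder.const (4 * Real.pi)).mul
          (hrho.add (IsSymbolOrder.const (-1))))).mul
          (hc.inv (δ := 99 / 100) (by norm_num) fun χ hχ => hS.c_ge hχ)))))⟩
    · have := r_ne hχ
      exact (hasDerivWithinAt_r hχ).congr_deriv (by field_simp)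
    · ring
    · have := r_ne hχ
      rw [G_eq hχ]
      have := (c_pos hχ).ne'
      field_simp
      ring

lemma isSymbol_r : S.IsSymbol S.r := fun _ => hS.isSymbolOrder_base.1
lemma isSymbol_mu : S.IsSymbol S.mu := fun _ => hS.isSymbolOrder_base.2.1
lemma isSymbol_rho : S.IsSymbol S.rho := fun _ => hS.isSymbolOrder_base.2.2
lemma isSymbol_c : S.IsSymbol S.c := fun k =>
  (hS.isSymbolOrder_s (hS.isSymbol_r k) (hS.isSymbol_mu k) (hS.isSymbol_rho k)).1
lemma isSymbol_n : S.IsSymbol S.n := fun k =>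
  (hS.isSymbolOrder_s (hS.isSymbol_r k) (hS.isSymbol_mu k) (hS.isSymbol_rho k)).2.1
lemma isSymbol_s : S.IsSymbol S.s := fun k =>
  (hS.isSymbolOrder_s (hS.isSymbol_r k) (hS.isSymbol_mu k) (hS.isSymbol_rho k)).2.2

lemma isSymbol_inv_c : S.IsSymbol (fun χ => (S.c χ)⁻¹) :=
  hS.isSymbol_c.inv (δ := 99 / 100) (by norm_num) fun χ hχ => hS.c_ge hχ

lemma s_ge (hχ : χ ∈ Ioc 0 S.B) : 1 / 100 ≤ S.s χ := by
  have h1 : 9 / 10 ≤ √(S.c χ) := Real.le_sqrt_of_sq_le (by have := hS.c_ge hχ; linarith)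
  have h2 := n_pos hχ
  have h3 := hS.n_le hχ
  have := Real.pi_pos
  have := Real.pi_lt_d2
  rw [s, le_div_iff₀ (by positivity)]
  nlinarith

omit hS in
lemma s_le (hχ : χ ∈ Ioc 0 S.B) : S.s χ ≤ 1 := by
  have h1 : √(S.c χ) ≤ 1 := Real.sqrt_le_one.2 (c_le hχ)
  have h2 := one_le_n hχ
  have := Real.pi_gt_three
  rw [s, div_le_iff₀ (by positivity)]
  nlinarith

lemma isSymbol_G : S.IsSymbol S.G :=
  (hS.isSymbol_r.mul (hS.isSymbol_mu.add ((IsSymbol.const (4 * Real.pi)).mul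
    (hS.isSymbol_rho.add (IsSymbol.const (-1)))))).congr fun χ hχ => by rw [G_eq hχ]; ring

lemma isSymbol_q : S.IsSymbol S.q :=
  (hS.isSymbol_G.mul hS.isSymbol_inv_c).congr fun χ hχ => by
    rw [q_eq hχ, div_eq_mul_inv]

lemma isSymbol_h : S.IsSymbol S.h :=
  (hS.isSymbol_r.mul (((IsSymbol.const (4 * Real.pi)).mul hS.isSymbol_rho).add
    hS.isSymbol_mu.neg)).congr fun χ hχ => by rw [h_eq hχ]; ring

lemma isSymbol_V : S.IsSymbol S.V :=
  ((hS.isSymbol_q.mul hS.isSymbol_G).add (((IsSymbol.const 2).mul (hS.isSymbol_mu.add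
    ((IsSymbol.const (4 * Real.pi)).mul (hS.isSymbol_rho.add (IsSymbol.const (-1)))))).add
    ((IsSymbol.const 2).mul hS.isSymbol_mu))).congr fun χ hχ => by
      have := r_ne hχ
      rw [V, G_eq hχ]; field_simp; ring

end IsSmall

/-- Away from the centre r₀ > 0, so ordinary derivatives are recovered by dividing by r₀³. -/
lemma contDiffOn_of_isSymbol (hS : S.IsSmall) (hf : S.IsSymbol f) :
    ContDiffOn ℝ k f (Ioc 0 S.B) := by
  induction k generalizing f with
  | zero =>
    exact contDiffOn_zero.2 fun χ hχ => ((hf 1).2.1 χ hχ).continuousWithinAt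
  | succ k ih =>
    push_cast
    rw [contDiffOn_succ_iff_derivWithin (uniqueDiffOn_Ioc 0 S.B)]
    refine ⟨(hf 1).2.1, by simp, ?_⟩
    refine ((ih hf.scaled_deriv).div ((ih hS.isSymbol_r).pow 3)
      (fun χ hχ => pow_ne_zero 3 (r_ne hχ))).congr fun χ hχ => ?_
    have := r_ne hχ
    simp only [dχ, Pi.div_apply]; field_simp

lemma IsSymbol.contDiffOn (hS : S.IsSmall) (hf : S.IsSymbol f) :
    ContDiffOn ℝ ∞ f (Ioc 0 S.B) :=
  contDiffOn_infty.2 fun _ => contDiffOn_of_isSymbol hS hf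

end StaticHardStar

/-! ### Smooth functions on the space-time domain and their one-sided partial derivatives. -/

namespace StaticHardStar

variable (S : StaticHardStar)

/-- Smoothness on the space-time domain. -/
def Smooth (f : ℝ → ℝ → ℝ) : Prop := ContDiffOn ℝ ∞ (fun p : ℝ × ℝ => f p.1 p.2) S.domain

variable {S} {φ χ : ℝ} {f g : ℝ → ℝ → ℝ}

lemma uniqueDiffOn_domain : UniqueDiffOn ℝ S.domain :=
  (uniqueDiffOn_Ici 0).prod (uniqueDiffOn_Ioc 0 S.B)

lemma mem_domain (hφ : 0 ≤ φ) (hχ : χ ∈ Ioc 0 S.B) : (φ, χ) ∈ S.domain := ⟨hφ, hχ⟩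

namespace Smooth

lemma hasFDerivWithinAt (hf : S.Smooth f) (hφ : 0 ≤ φ) (hχ : χ ∈ Ioc 0 S.B) :
    HasFDerivWithinAt (fun p : ℝ × ℝ => f p.1 p.2)
      (fderivWithin ℝ (fun p : ℝ × ℝ => f p.1 p.2) S.domain (φ, χ)) S.domain (φ, χ) :=
  ((hf.differentiableOn (by simp)) (φ, χ) (mem_domain hφ hχ)).hasFDerivWithinAt

lemma hasDerivWithinAt_left (hf : S.Smooth f) (hφ : 0 ≤ φ) (hχ : χ ∈ Ioc 0 S.B) :
    HasDerivWithinAt (fun t => f t χ)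
      (fderivWithin ℝ (fun p : ℝ × ℝ => f p.1 p.2) S.domain (φ, χ) (1, 0)) (Ici 0) φ := by
  have h1 : HasDerivWithinAt (fun t : ℝ => (t, χ)) ((1, 0) : ℝ × ℝ) (Ici 0) φ :=
    (hasDerivWithinAt_id φ _).prodMk (hasDerivWithinAt_const φ _ χ)
  exact (hf.hasFDerivWithinAt hφ hχ).comp_hasDerivWithinAt φ h1 (fun t ht => mem_domain ht hχ)

lemma hasDerivWithinAt_right (hf : S.Smooth f) (hφ : 0 ≤ φ) (hχ : χ ∈ Ioc 0 S.B) :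
    HasDerivWithinAt (f φ)
      (fderivWithin ℝ (fun p : ℝ × ℝ => f p.1 p.2) S.domain (φ, χ) (0, 1)) (Ioc 0 S.B) χ := by
  have h1 : HasDerivWithinAt (fun t : ℝ => (φ, t)) ((0, 1) : ℝ × ℝ) (Ioc 0 S.B) χ :=
    (hasDerivWithinAt_const χ _ φ).prodMk (hasDerivWithinAt_id χ _)
  exact (hf.hasFDerivWithinAt hφ hχ).comp_hasDerivWithinAt χ h1 (fun t ht => mem_domain hφ ht)

lemma pφ_eq (hf : S.Smooth f) (hφ : 0 ≤ φ) (hχ : χ ∈ Ioc 0 S.B) :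
    pφ f φ χ = fderivWithin ℝ (fun p : ℝ × ℝ => f p.1 p.2) S.domain (φ, χ) (1, 0) :=
  (hf.hasDerivWithinAt_left hφ hχ).derivWithin (uniqueDiffOn_Ici 0 φ hφ)

lemma pχ_eq (hf : S.Smooth f) (hφ : 0 ≤ φ) (hχ : χ ∈ Ioc 0 S.B) :
    S.pχ f φ χ = fderivWithin ℝ (fun p : ℝ × ℝ => f p.1 p.2) S.domain (φ, χ) (0, 1) :=
  (hf.hasDerivWithinAt_right hφ hχ).derivWithin (uniqueDiff hχ)

lemma hasDeriv_φ (hf : S.Smooth f) (hφ : 0 ≤ φ) (hχ : χ ∈ Ioc 0 S.B) :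
    HasDerivWithinAt (fun t => f t χ) (pφ f φ χ) (Ici 0) φ := by
  rw [hf.pφ_eq hφ hχ]; exact hf.hasDerivWithinAt_left hφ hχ

lemma hasDeriv_χ (hf : S.Smooth f) (hφ : 0 ≤ φ) (hχ : χ ∈ Ioc 0 S.B) :
    HasDerivWithinAt (f φ) (S.pχ f φ χ) (Ioc 0 S.B) χ := by
  rw [hf.pχ_eq hφ hχ]; exact hf.hasDerivWithinAt_right hφ hχ

lemma congr (hf : S.Smooth f) (h : ∀ φ, 0 ≤ φ → ∀ χ ∈ Ioc 0 S.B, g φ χ = f φ χ) :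
    S.Smooth g :=
  ContDiffOn.congr hf fun p hp => h p.1 hp.1 p.2 hp.2

lemma fderivWithin_apply (hf : S.Smooth f) (v : ℝ × ℝ) :
    ContDiffOn ℝ ∞ (fun p => fderivWithin ℝ (fun p : ℝ × ℝ => f p.1 p.2) S.domain p v)
      S.domain :=
  (ContDiffOn.fderivWithin hf uniqueDiffOn_domain (by simp)).clm_apply contDiffOn_const

lemma deriv_φ (hf : S.Smooth f) : S.Smooth (pφ f) :=
  ContDiffOn.congr (hf.fderivWithin_apply (1, 0)) fun _ hp => hf.pφ_eq hp.1 hp.2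

lemma deriv_χ (hf : S.Smooth f) : S.Smooth (S.pχ f) :=
  ContDiffOn.congr (hf.fderivWithin_apply (0, 1)) fun _ hp => hf.pχ_eq hp.1 hp.2

lemma pφ_iterate (hf : S.Smooth f) (j : ℕ) : S.Smooth (pφ^[j] f) := by
  induction j with
  | zero => exact hf
  | succ j ih => rw [Function.iterate_succ_apply']; exact ih.deriv_φ

lemma add (hf : S.Smooth f) (hg : S.Smooth g) : S.Smooth (fun φ χ => f φ χ + g φ χ) :=
  ContDiffOn.add hf hg

lemma mul (hf : S.Smooth f) (hg : S.Smooth g) : S.Smooth (fun φ χ => f φ χ * g φ χ) :=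
  ContDiffOn.mul hf hg

lemma of_coeff {a : ℝ → ℝ} (ha : ContDiffOn ℝ ∞ a (Ioc 0 S.B)) : S.Smooth (fun _ χ => a χ) :=
  ha.comp contDiffOn_snd fun _ hp => hp.2

lemma smul {a : ℝ → ℝ} (ha : ContDiffOn ℝ ∞ a (Ioc 0 S.B)) (hf : S.Smooth f) :
    S.Smooth (fun φ χ => a χ * f φ χ) :=
  (of_coeff ha).mul hf

lemma continuousOn_slice (hf : S.Smooth f) (hφ : 0 ≤ φ) : ContinuousOn (f φ) (Ioc 0 S.B) :=
  fun _ hχ => (hf.hasDeriv_χ hφ hχ).continuousWithinAt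

lemma subset_closure_interior : S.domain ⊆ closure (interior S.domain) := by
  have h1 : interior S.domain = Ioi 0 ×ˢ Ioo 0 S.B := by
    rw [domain, interior_prod_eq, interior_Ici, interior_Ioc]
  rw [h1, closure_prod_eq, closure_Ioi, closure_Ioo S.B_pos.ne]
  exact prod_mono le_rfl Ioc_subset_Icc_self

/-- Mixed partial derivatives commute up to the boundary of the domain. -/
lemma pφ_pχ (hf : S.Smooth f) (hφ : 0 ≤ φ) (hχ : χ ∈ Ioc 0 S.B) :
    pφ (S.pχ f) φ χ = S.pχ (pφ f) φ χ := by
  set F := fun p : ℝ × ℝ => f p.1 p.2 with hF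
  have hx := mem_domain hφ hχ
  have hsymm : IsSymmSndFDerivWithinAt ℝ F S.domain (φ, χ) :=
    -- Symmetry of the second derivative persists at boundary points because the domain lies in the
    -- closure of its interior.
    (hf (φ, χ) hx).isSymmSndFDerivWithinAt
      (by rw [minSmoothness_of_isRCLikeNormedField]; exact ENat.LEInfty.out) uniqueDiffOn_domain
      (subset_closure_interior hx) hx
  have hd : DifferentiableWithinAt ℝ (fderivWithin ℝ F S.domain) S.domain (φ, χ) :=
    ((ContDiffOn.fderivWithin hf uniqueDiffOn_domain (m := 1)
      (by rw [one_add_one_eq_two]; exact ENat.LEInfty.out)).differentiableOn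
      one_ne_zero) (φ, χ) hx
  have key : ∀ v : ℝ × ℝ, fderivWithin ℝ (fun p => fderivWithin ℝ F S.domain p v) S.domain (φ, χ)
      = (fderivWithin ℝ (fderivWithin ℝ F S.domain) S.domain (φ, χ)).flip v := by
    intro v
    exact (hd.hasFDerivWithinAt.clm_apply (hasFDerivWithinAt_const v (φ, χ) S.domain)).fderivWithin
      (uniqueDiffOn_domain _ hx) |>.trans (by simp)
  have e1 : fderivWithin ℝ (fun p : ℝ × ℝ => S.pχ f p.1 p.2) S.domain (φ, χ)
      = fderivWithin ℝ (fun p => fderivWithin ℝ F S.domain p (0, 1)) S.domain (φ, χ) :=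
    fderivWithin_congr (fun p hp => hf.pχ_eq hp.1 hp.2) (hf.pχ_eq hφ hχ)
  have e2 : fderivWithin ℝ (fun p : ℝ × ℝ => pφ f p.1 p.2) S.domain (φ, χ)
      = fderivWithin ℝ (fun p => fderivWithin ℝ F S.domain p (1, 0)) S.domain (φ, χ) :=
    fderivWithin_congr (fun p hp => hf.pφ_eq hp.1 hp.2) (hf.pφ_eq hφ hχ)
  rw [hf.deriv_χ.pφ_eq hφ hχ, hf.deriv_φ.pχ_eq hφ hχ, e1, e2, key, key]
  exact hsymm _ _

end Smooth

lemma pφ_congr (h : ∀ φ, 0 ≤ φ → ∀ χ ∈ Ioc 0 S.B, f φ χ = g φ χ) (hφ : 0 ≤ φ)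
    (hχ : χ ∈ Ioc 0 S.B) : pφ f φ χ = pφ g φ χ :=
  derivWithin_congr (fun t ht => h t ht χ hχ) (h φ hφ χ hχ)

lemma pχ_congr (h : ∀ φ, 0 ≤ φ → ∀ χ ∈ Ioc 0 S.B, f φ χ = g φ χ) (hφ : 0 ≤ φ)
    (hχ : χ ∈ Ioc 0 S.B) : S.pχ f φ χ = S.pχ g φ χ :=
  derivWithin_congr (fun x hx => h φ hφ x hx) (h φ hφ χ hχ)

lemma pφ_of_hasDeriv {a : ℝ} (hφ : 0 ≤ φ)
    (h : HasDerivWithinAt (fun t => f t χ) a (Ici 0) φ) : pφ f φ χ = a :=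
  h.derivWithin (uniqueDiffOn_Ici 0 φ hφ)

lemma pχ_of_hasDeriv {a : ℝ} (hχ : χ ∈ Ioc 0 S.B)
    (h : HasDerivWithinAt (f φ) a (Ioc 0 S.B) χ) : S.pχ f φ χ = a :=
  h.derivWithin (uniqueDiff hχ)

end StaticHardStar

/-! ### The wave equation in divergence form. -/

namespace StaticHardStar

variable (S : StaticHardStar)

/-- The first order operator `u ↦ ∂_χ u / ∂_χ r₀ + (2 / r₀ - q) u`. -/
def lin (u : ℝ → ℝ → ℝ) : ℝ → ℝ → ℝ :=
  fun φ χ => S.r χ ^ 2 / S.s χ * S.pχ u φ χ + S.p χ * u φ χ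

/-- Smooth solutions of the linearised equation in divergence form, vanishing at the centre, with
the boundary condition `lin u = θ (2 / r₀ - q) u`. -/
structure IsWave (θ : ℝ) (u : ℝ → ℝ → ℝ) : Prop where
  smooth : S.Smooth u
  wave : ∀ φ : ℝ, 0 ≤ φ → ∀ χ ∈ Ioc 0 S.B, S.n χ ^ 2 * pφ (pφ u) φ χ =
    S.c χ * (S.r χ ^ 2 / S.s χ * S.pχ (S.lin u) φ χ) + S.h χ * S.lin u φ χ + S.V χ * u φ χ
  centre : ∀ (j : ℕ) (φ : ℝ), 0 ≤ φ →
    Tendsto (fun p : ℝ × ℝ => (pφ^[j] u) p.1 p.2) (𝓝[S.domain] (φ, 0)) (𝓝 0)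
  boundary : ∀ φ : ℝ, 0 ≤ φ → S.lin u φ S.B = θ * (S.p S.B * u φ S.B)

variable {S} {φ χ θ : ℝ} {u : ℝ → ℝ → ℝ}

namespace IsSmall

variable (hS : S.IsSmall)
include hS

lemma contDiffOn_inv_drdχ : ContDiffOn ℝ ∞ (fun χ => S.r χ ^ 2 / S.s χ) (Ioc 0 S.B) :=
  ((hS.isSymbol_r.contDiffOn hS).pow 2).div (hS.isSymbol_s.contDiffOn hS)
    fun _ hχ => (s_pos hχ).ne'

lemma contDiffOn_p : ContDiffOn ℝ ∞ S.p (Ioc 0 S.B) :=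
  (contDiffOn_const.div (hS.isSymbol_r.contDiffOn hS) fun _ hχ => r_ne hχ).sub
    (hS.isSymbol_q.contDiffOn hS)

lemma smooth_lin (hu : S.Smooth u) : S.Smooth (S.lin u) :=
  (hu.deriv_χ.smul hS.contDiffOn_inv_drdχ).add (hu.smul hS.contDiffOn_p)

omit hS in
lemma lin_pφ (hu : S.Smooth u) (hφ : 0 ≤ φ) (hχ : χ ∈ Ioc 0 S.B) :
    pφ (S.lin u) φ χ = S.lin (pφ u) φ χ := by
  rw [lin, ← hu.pφ_pχ hφ hχ]
  exact pφ_of_hasDeriv hφ (((hu.deriv_χ.hasDeriv_φ hφ hχ).const_mul _).add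
    ((hu.hasDeriv_φ hφ hχ).const_mul _))

end IsSmall

/-- The coefficients and θ do not depend on φ, so the equation and the boundary condition can be
differentiated; the centre condition is stable because it concerns all φ-derivatives. -/
lemma IsWave.deriv_φ (hS : S.IsSmall) (hu : S.IsWave θ u) : S.IsWave θ (pφ u) where
  smooth := hu.smooth.deriv_φ
  wave φ hφ χ hχ := by
    have hl := hS.smooth_lin hu.smooth
    have h1 := pφ_congr (f := fun φ χ => S.n χ ^ 2 * pφ (pφ u) φ χ) hu.wave hφ hχ
    have h2 := pφ_of_hasDeriv (f := fun φ χ => S.n χ ^ 2 * pφ (pφ u) φ χ) hφ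
      ((hu.smooth.deriv_φ.deriv_φ.hasDeriv_φ hφ hχ).const_mul (S.n χ ^ 2))
    have h3 := pφ_of_hasDeriv (f := fun φ χ =>
      S.c χ * (S.r χ ^ 2 / S.s χ * S.pχ (S.lin u) φ χ) + S.h χ * S.lin u φ χ + S.V χ * u φ χ) hφ
      (((((hl.deriv_χ.hasDeriv_φ hφ hχ).const_mul (S.r χ ^ 2 / S.s χ)).const_mul (S.c χ)).add
        ((hl.hasDeriv_φ hφ hχ).const_mul (S.h χ))).add
        ((hu.smooth.hasDeriv_φ hφ hχ).const_mul (S.V χ)))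
    rw [h2, h3, hl.pφ_pχ hφ hχ, IsSmall.lin_pφ hu.smooth hφ hχ,
      pχ_congr (fun φ hφ χ hχ => IsSmall.lin_pφ hu.smooth hφ hχ) hφ hχ] at h1
    exact h1
  centre j φ hφ := by
    have := hu.centre (j + 1) φ hφ
    rwa [Function.iterate_succ] at this
  boundary φ hφ := by
    have h1 : pφ (S.lin u) φ S.B = θ * (S.p S.B * pφ u φ S.B) := by
      rw [pφ, derivWithin_congr (s := Ici 0) (fun t ht => hu.boundary t ht)
        (hu.boundary φ hφ)]
      exact (((hu.smooth.hasDeriv_φ hφ right_mem).const_mul _).const_mul _).derivWithin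
        (uniqueDiffOn_Ici 0 φ hφ)
    rwa [IsSmall.lin_pφ hu.smooth hφ right_mem] at h1

lemma IsWave.pφ_iterate (hS : S.IsSmall) (hu : S.IsWave θ u) (j : ℕ) :
    S.IsWave θ (pφ^[j] u) := by
  induction j with
  | zero => exact hu
  | succ j ih => rw [Function.iterate_succ_apply']; exact ih.deriv_φ hS

/-- Since G / ∂_χ ψ₀ = c / ∂_χ r₀, the two second-order terms merge into c D(`lin` u). Splitting 4π
r₀ n² = h + G then completes h Du to h `lin` u and leaves exactly V u. -/
lemma MasterEquation.wave (hS : S.IsSmall) (hu : S.Smooth u) (hφ : 0 ≤ φ) (hχ : χ ∈ Ioc 0 S.B)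
    (hm : S.MasterEquation u φ χ) : S.n χ ^ 2 * pφ (pφ u) φ χ =
    S.c χ * (S.r χ ^ 2 / S.s χ * S.pχ (S.lin u) φ χ) + S.h χ * S.lin u φ χ + S.V χ * u φ χ := by
  have hr := r_ne hχ
  have hs := (s_pos hχ).ne'
  have hc := (c_pos hχ).ne'
  have hG := (G_pos hχ).ne'
  have d1 := (hu.deriv_χ.smul hS.contDiffOn_inv_drdχ).hasDeriv_χ hφ hχ
  have d2 := (hu.smul hS.contDiffOn_p).hasDeriv_χ hφ hχ
  have e1 : S.dχ (fun x => S.pχ u φ x / S.dχ S.r x) χ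
      = S.pχ (fun φ χ => S.r χ ^ 2 / S.s χ * S.pχ u φ χ) φ χ := by
    refine dχ_congr (fun x hx => ?_) hχ
    have := r_ne hx
    have := (s_pos hx).ne'
    rw [dχ_r hx]; field_simp
  have e2 : S.dχ (fun x => (2 / S.r x - S.q x) * u φ x) χ
      = S.pχ (fun φ χ => S.p χ * u φ χ) φ χ := rfl
  have e3 : S.pχ (S.lin u) φ χ = S.pχ (fun φ χ => S.r χ ^ 2 / S.s χ * S.pχ u φ χ) φ χ
      + S.pχ (fun φ χ => S.p χ * u φ χ) φ χ := pχ_of_hasDeriv hχ (d1.add d2)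
  have e4 : S.G χ * (1 / S.dχ S.psi χ) = S.c χ * (S.r χ ^ 2 / S.s χ) := by
    rw [dχ_psi hχ]; field_simp
  rw [MasterEquation, e1, e2, e4, ← n_sq hχ, dχ_r hχ] at hm
  rw [e3, lin]
  have e5 : S.pχ u φ χ / (S.s χ / S.r χ ^ 2) = S.r χ ^ 2 / S.s χ * S.pχ u φ χ := by field_simp
  rw [e5] at hm
  have e6 : 4 * Real.pi * S.r χ * S.n χ ^ 2 = S.h χ + S.G χ := by
    rw [h, G, n_sq hχ]; ring
  have e7 : S.V χ = 2 * S.q χ * S.G χ + 2 * (S.m χ / S.r χ ^ 3) + S.G χ * S.p χ := by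
    unfold V p mu; ring
  rw [e6] at hm
  rw [e7]
  have e8 : 4 * Real.pi * S.r χ * S.rho χ - S.m χ / S.r χ ^ 2 = S.h χ := rfl
  have e9 : 2 / S.r χ - S.q χ = S.p χ := rfl
  rw [e8, e9] at hm
  linear_combination hm

lemma IsLinearisedSolution.isWave (hS : S.IsSmall) {r₁ rho₁ n₁ psi₁ omega₁ m₁ : ℝ → ℝ → ℝ}
    (h : S.IsLinearisedSolution r₁ rho₁ n₁ psi₁ omega₁ m₁) :
    ∃ θ : ℝ, 0 ≤ θ ∧ θ ≤ 1 ∧ S.IsWave θ r₁ := by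
  have hr := S.r_pos _ (right_mem (S := S))
  have hs := s_pos (right_mem (S := S))
  have key : ∀ θ : ℝ, (∀ φ : ℝ, 0 ≤ φ → S.lin r₁ φ S.B = θ * (S.p S.B * r₁ φ S.B)) →
      S.IsWave θ r₁ := fun θ hθ =>
    ⟨h.smooth, fun φ hφ χ hχ => (h.wave φ hφ χ hχ).wave hS h.smooth hφ hχ, h.centre, hθ⟩
  rcases h.boundary with hb | hb
  -- Here θ = 1 - 1/∂_χ r₀(B), which is nonnegative because ∂_χ r₀ = s/r₀² is large for a small
  -- star. The condition ψ₁ = 0 is the case θ = 0.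
  · refine ⟨1 - S.r S.B ^ 2 / S.s S.B, ?_, ?_, key _ fun φ hφ => ?_⟩
    · rw [sub_nonneg, div_le_one hs]
      linarith [hS.r_sq_lt right_mem, hS.s_ge right_mem]
    · have : 0 ≤ S.r S.B ^ 2 / S.s S.B := by positivity
      linarith
    · rw [lin, hb φ hφ, p]; ring
  · refine ⟨0, le_rfl, zero_le_one, key _ fun φ hφ => ?_⟩
    rw [lin, hb φ hφ, dχ_r right_mem, p]
    field_simp
    ring

end StaticHardStar

/-! ### Regularity of solutions at the centre. -/

namespace StaticHardStar

variable {S : StaticHardStar} {φ χ θ : ℝ} {u : ℝ → ℝ → ℝ}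

lemma monotoneOn_Ioc {f f' : ℝ → ℝ}
    (hd : ∀ χ ∈ Ioc 0 S.B, HasDerivWithinAt f (f' χ) (Ioc 0 S.B) χ)
    (h0 : ∀ χ ∈ Ioc 0 S.B, 0 ≤ f' χ) : MonotoneOn f (Ioc 0 S.B) := by
  refine monotoneOn_of_hasDerivWithinAt_nonneg (f' := f') (convex_Ioc _ _)
    (fun x hx => (hd x hx).continuousWithinAt) ?_ ?_
  · rw [interior_Ioc]
    exact fun x hx => (hd x (Ioo_sub hx)).mono Ioo_sub
  · rw [interior_Ioc]
    exact fun x hx => h0 x (Ioo_sub hx)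

/-- Comparison of increments of two functions on `(0, B]`. -/
lemma abs_sub_le_of_deriv {f f' g g' : ℝ → ℝ}
    (hf : ∀ χ ∈ Ioc 0 S.B, HasDerivWithinAt f (f' χ) (Ioc 0 S.B) χ)
    (hg : ∀ χ ∈ Ioc 0 S.B, HasDerivWithinAt g (g' χ) (Ioc 0 S.B) χ)
    (h : ∀ χ ∈ Ioc 0 S.B, |f' χ| ≤ g' χ) {x y : ℝ} (hx : x ∈ Ioc 0 S.B) (hy : y ∈ Ioc 0 S.B)
    (hxy : x ≤ y) : |f y - f x| ≤ g y - g x := by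
  have h1 := monotoneOn_Ioc (fun χ hχ => (hg χ hχ).sub (hf χ hχ))
    (fun χ hχ => by linarith [(abs_le.1 (h χ hχ)).2]) hx hy hxy
  have h2 := monotoneOn_Ioc (fun χ hχ => (hg χ hχ).add (hf χ hχ))
    (fun χ hχ => by linarith [(abs_le.1 (h χ hχ)).1]) hx hy hxy
  simp only [Pi.add_apply, Pi.sub_apply] at h1 h2
  rw [abs_le]; constructor <;> linarith

namespace IsWave

/-- The solution has a limit within the domain at every point of the compact rectangle, including
those with χ = 0, hence is locally bounded there; compactness gives a global bound. -/
lemma bounded (hu : S.IsWave θ u) (T : ℝ) :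
    ∃ K, ∀ φ ∈ Icc 0 T, ∀ χ ∈ Ioc 0 S.B, |u φ χ| ≤ K := by
  have hK : IsCompact (Icc 0 T ×ˢ Icc 0 S.B) := isCompact_Icc.prod isCompact_Icc
  have key : ∃ K, ∀ p ∈ (Icc 0 T ×ˢ Icc 0 S.B) ∩ S.domain, |u p.1 p.2| ≤ K := by
    refine hK.induction_on (p := fun s => ∃ K, ∀ p ∈ s ∩ S.domain, |u p.1 p.2| ≤ K) ?_ ?_ ?_ ?_
    · exact ⟨0, by simp⟩
    · rintro s t hst ⟨K, hK⟩
      exact ⟨K, fun p hp => hK p ⟨hst hp.1, hp.2⟩⟩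
    · rintro s t ⟨K, hK⟩ ⟨K', hK'⟩
      refine ⟨max K K', fun p hp => ?_⟩
      rcases hp.1 with h | h
      · exact (hK p ⟨h, hp.2⟩).trans (le_max_left _ _)
      · exact (hK' p ⟨h, hp.2⟩).trans (le_max_right _ _)
    · rintro ⟨φ, χ⟩ ⟨hφ, hχ⟩
      have hl : ∃ l, Tendsto (fun p : ℝ × ℝ => u p.1 p.2) (𝓝[S.domain] (φ, χ)) (𝓝 l) := by
        rcases hχ.1.eq_or_lt with h | h
        · simp only at h
          rw [← h]; exact ⟨0, hu.centre 0 φ hφ.1⟩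
        · exact ⟨_, hu.smooth.continuousOn (φ, χ) (mem_domain hφ.1 ⟨h, hχ.2⟩)⟩
      obtain ⟨l, hl⟩ := hl
      have h1 : ∀ᶠ p in 𝓝[S.domain] (φ, χ), |u p.1 p.2| < |l| + 1 :=
        hl.abs.eventually_lt_const (by linarith)
      rw [eventually_nhdsWithin_iff] at h1
      refine ⟨_, mem_nhdsWithin_of_mem_nhds h1, |l| + 1, fun p hp => (hp.1 hp.2).le⟩
  obtain ⟨K, hK⟩ := key
  exact ⟨K, fun φ hφ χ hχ => hK (φ, χ) ⟨⟨hφ, Ioc_sub hχ⟩, hφ.1, hχ⟩⟩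

/-- As Dc = -2h, the factor 1/√c is an integrating factor that removes the term h `lin` u. -/
lemma hasDeriv_lin_div_sqrt (hS : S.IsSmall) (hu : S.IsWave θ u) (hφ : 0 ≤ φ)
    (hχ : χ ∈ Ioc 0 S.B) :
    HasDerivWithinAt (fun χ => S.lin u φ χ / √(S.c χ))
      (S.s χ / S.r χ ^ 2 / (S.c χ * √(S.c χ)) * (S.n χ ^ 2 * pφ (pφ u) φ χ - S.V χ * u φ χ))
      (Ioc 0 S.B) χ := by
  have hc := c_pos hχ
  have hc' := Real.sqrt_pos.2 hc
  have hr := r_ne hχ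
  have hs := (s_pos hχ).ne'
  have h1 := ((hS.smooth_lin hu.smooth).hasDeriv_χ hφ hχ).div
    ((hasDerivWithinAt_c hχ).sqrt hc.ne') hc'.ne'
  refine h1.congr_deriv ?_
  rw [hu.wave φ hφ χ hχ, Real.sq_sqrt hc.le]
  field_simp
  rw [Real.sq_sqrt hc.le]
  ring

/-- The equation `∂_χ (r₀² n₀ u) = r₀² n₀ ∂_χ r₀ lin u`. -/
lemma hasDeriv_weighted (hu : S.Smooth u) (hφ : 0 ≤ φ) (hχ : χ ∈ Ioc 0 S.B) :
    HasDerivWithinAt (fun χ => S.r χ ^ 2 * S.n χ * u φ χ)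
      (S.s χ * S.n χ * S.lin u φ χ) (Ioc 0 S.B) χ := by
  have hr := r_ne hχ
  have hs := (s_pos hχ).ne'
  have h1 := (((hasDerivWithinAt_r hχ).pow 2).mul (hasDerivWithinAt_n hχ)).mul
    (hu.hasDeriv_χ hφ hχ)
  refine h1.congr_deriv ?_
  simp only [lin, p, Pi.mul_apply, Pi.pow_apply]
  push_cast
  field_simp
  ring

/-- The χ-derivative of `lin` u / √c is a bounded multiple of ∂_χ r₀, because u and ∂_φ²u are
bounded. Integrating inwards from B, where the boundary condition controls `lin` u by u, gives the
bound. -/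
lemma bounded_lin (hS : S.IsSmall) (hu : S.IsWave θ u) (T : ℝ) :
    ∃ K, ∀ φ ∈ Icc 0 T, ∀ χ ∈ Ioc 0 S.B, |S.lin u φ χ| ≤ K := by
  obtain ⟨K0, hK0⟩ := hu.bounded T
  obtain ⟨K1, hK1⟩ := ((hu.deriv_φ hS).deriv_φ hS).bounded T
  have hB := right_mem (S := S)
  set b := |θ * S.p S.B| * K0 / √(S.c S.B) with hb
  refine ⟨b + 2 * (2 * K1 + 20 * K0), fun φ hφ χ hχ => ?_⟩
  have k0 : 0 ≤ K0 := (abs_nonneg _).trans (hK0 φ hφ _ hB)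
  have k1 : 0 ≤ K1 := (abs_nonneg _).trans (hK1 φ hφ _ hB)
  have h1 := abs_sub_le_of_deriv (fun χ hχ => hu.hasDeriv_lin_div_sqrt hS hφ.1 hχ)
    (fun χ hχ => (hasDerivWithinAt_r hχ).const_mul (2 * (2 * K1 + 20 * K0)))
    (fun χ hχ => by
      have hc := hS.c_ge hχ
      have hc' : 9 / 10 ≤ √(S.c χ) := Real.le_sqrt_of_sq_le (by linarith)
      have hs := s_pos hχ
      have hr := S.r_pos χ hχ
      have e : |S.n χ ^ 2 * pφ (pφ u) φ χ - S.V χ * u φ χ| ≤ 2 * K1 + 20 * K0 := by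
        refine (abs_sub _ _).trans ?_
        rw [abs_mul, abs_mul, abs_of_nonneg (IsSmall.V_nonneg hχ), abs_of_nonneg (sq_nonneg (S.n χ))]
        gcongr
        · linarith [hS.n_sq_le hχ]
        · exact hK1 φ hφ χ hχ
        · exact hS.V_le hχ
        · exact hK0 φ hφ χ hχ
      have e2 : 1 / (S.c χ * √(S.c χ)) ≤ 2 := by
        rw [div_le_iff₀ (by positivity)]; nlinarith
      rw [abs_mul, abs_of_nonneg (by positivity)]
      set w := |S.n χ ^ 2 * pφ (pφ u) φ χ - S.V χ * u φ χ|
      calc S.s χ / S.r χ ^ 2 / (S.c χ * √(S.c χ)) * w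
          = S.s χ / S.r χ ^ 2 * (1 / (S.c χ * √(S.c χ)) * w) := by ring
        _ ≤ S.s χ / S.r χ ^ 2 * (2 * (2 * K1 + 20 * K0)) := by gcongr
        _ = _ := by ring) hχ hB hχ.2
  have h2 : |S.lin u φ S.B / √(S.c S.B)| ≤ b := by
    rw [hu.boundary φ hφ.1, ← mul_assoc, abs_div, abs_mul, abs_of_nonneg (Real.sqrt_nonneg _), hb]
    gcongr
    exact hK0 φ hφ _ hB
  have h3 : 2 * (2 * K1 + 20 * K0) * S.r S.B - 2 * (2 * K1 + 20 * K0) * S.r χ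
      ≤ 2 * (2 * K1 + 20 * K0) := by
    have := hS.r_lt hB
    have := S.r_pos χ hχ
    have : 0 ≤ 2 * (2 * K1 + 20 * K0) := by positivity
    nlinarith
  have hc' := Real.sqrt_pos.2 (c_pos hχ)
  have h4 : |S.lin u φ χ| ≤ |S.lin u φ χ / √(S.c χ)| := by
    rw [abs_div, le_div_iff₀ (abs_pos.2 hc'.ne'), abs_of_pos hc']
    exact mul_le_of_le_one_right (abs_nonneg _) (Real.sqrt_le_one.2 (IsSmall.c_le hχ))
  have h5 := abs_sub_abs_le_abs_sub (S.lin u φ χ / √(S.c χ)) (S.lin u φ S.B / √(S.c S.B))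
  rw [abs_sub_comm] at h5
  linarith

lemma tendsto_centre (hu : S.IsWave θ u) (hφ : 0 ≤ φ) : Tendsto (u φ) (𝓝[Ioc 0 S.B] 0) (𝓝 0) := by
  have h1 : Tendsto (fun x : ℝ => (φ, x)) (𝓝[Ioc 0 S.B] 0) (𝓝[S.domain] (φ, 0)) := by
    refine tendsto_nhdsWithin_iff.2 ⟨?_, ?_⟩
    · exact ((Continuous.prodMk_right φ).tendsto 0).mono_left nhdsWithin_le_nhds
    · filter_upwards [self_mem_nhdsWithin] with x hx using mem_domain hφ hx
  exact (hu.centre 0 φ hφ).comp h1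

instance centre_neBot : (𝓝[Ioc 0 S.B] (0 : ℝ)).NeBot := by
  rw [nhdsWithin_Ioc_eq_nhdsGT S.B_pos]; infer_instance

/-- The quantity r₀² n u has derivative s n `lin` u, which is at most a multiple of ∂_χ(r₀³) = 3s.
Integrating from the centre, where u vanishes, gives r₀²|u| ≲ r₀³. -/
lemma linear_bound (hS : S.IsSmall) (hu : S.IsWave θ u) (T : ℝ) :
    ∃ K, ∀ φ ∈ Icc 0 T, ∀ χ ∈ Ioc 0 S.B, |S.lin u φ χ| ≤ K ∧ |u φ χ| ≤ K * S.r χ := by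
  obtain ⟨K, hK⟩ := hu.bounded_lin hS T
  refine ⟨K, fun φ hφ χ hχ => ⟨hK φ hφ χ hχ, ?_⟩⟩
  have k0 : 0 ≤ K := (abs_nonneg _).trans (hK φ hφ χ hχ)
  have hr := S.r_pos χ hχ
  -- The increment is taken from x > 0, and x tends to 0 afterwards. The constant 2/3 comes from n ≤
  -- 2 against ∂_χ(r₀³) = 3s.
  have h1 : ∀ᶠ x in 𝓝[Ioc 0 S.B] 0,
      |S.r χ ^ 2 * S.n χ * u φ χ| ≤ 2 / 3 * K * S.r χ ^ 3 + 2 * |u φ x| := by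
    have hev : ∀ᶠ x in 𝓝[Ioc 0 S.B] (0 : ℝ), x ≤ χ :=
      (eventually_nhdsWithin_of_eventually_nhds (eventually_le_nhds hχ.1))
    filter_upwards [self_mem_nhdsWithin, hev] with x hx hxχ
    have h2 := abs_sub_le_of_deriv (fun χ hχ => hasDeriv_weighted hu.smooth hφ.1 hχ)
      (fun χ hχ => ((hasDerivWithinAt_r hχ).pow 3).const_mul (2 / 3 * K))
      (fun χ hχ => by
        have hr := r_ne hχ
        have e : 2 / 3 * K * (((3 : ℕ) : ℝ) * S.r χ ^ (3 - 1) * (S.s χ / S.r χ ^ 2))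
            = S.s χ * 2 * K := by
          push_cast; field_simp
        rw [e, abs_mul, abs_mul, abs_of_pos (s_pos hχ), abs_of_pos (n_pos hχ)]
        have := (s_pos hχ).le
        gcongr
        · exact hS.n_le hχ
        · exact hK φ hφ χ hχ) hx hχ hxχ
    have h3 : |S.r x ^ 2 * S.n x * u φ x| ≤ 2 * |u φ x| := by
      have hn := n_pos hx
      rw [abs_mul, abs_of_pos (by have := S.r_pos x hx; positivity)]
      gcongr
      calc S.r x ^ 2 * S.n x ≤ 1 * 2 := by
            gcongr
            · linarith [hS.r_sq_lt hx]
            · exact hS.n_le hx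
        _ = 2 := one_mul 2
    have h4 := abs_sub_abs_le_abs_sub (S.r χ ^ 2 * S.n χ * u φ χ) (S.r x ^ 2 * S.n x * u φ x)
    have h5 : 0 ≤ 2 / 3 * K * S.r x ^ 3 := by have := S.r_pos x hx; positivity
    simp only [Pi.pow_apply] at h2
    linarith
  have h2 : Tendsto (fun x => 2 / 3 * K * S.r χ ^ 3 + 2 * |u φ x|) (𝓝[Ioc 0 S.B] 0)
      (𝓝 (2 / 3 * K * S.r χ ^ 3 + 2 * 0)) := by
    have := (hu.tendsto_centre hφ.1).abs
    rw [abs_zero] at this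
    exact (this.const_mul 2).const_add _
  have h3 := ge_of_tendsto h2 h1
  rw [abs_mul, abs_of_pos (by have := n_pos hχ; positivity)] at h3
  have h4 : S.r χ ^ 2 * |u φ χ| ≤ S.r χ ^ 2 * S.n χ * |u φ χ| := by
    have := IsSmall.one_le_n hχ
    have : 0 ≤ S.r χ ^ 2 * |u φ χ| := by positivity
    nlinarith
  have h5 : S.r χ ^ 2 * |u φ χ| ≤ S.r χ ^ 2 * (K * S.r χ) := by
    have : 0 ≤ K * S.r χ ^ 3 := by positivity
    nlinarith
  exact le_of_mul_le_mul_left h5 (by positivity)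

end IsWave
end StaticHardStar

/-! ### The conserved energy: local identity and coercivity. -/

namespace StaticHardStar

variable (S : StaticHardStar)

/-- The integrand of the energy. -/
def density (u : ℝ → ℝ → ℝ) (φ χ : ℝ) : ℝ :=
  u φ χ ^ 2 / S.r χ ^ 2 + pφ u φ χ ^ 2 + S.r χ ^ 4 * S.pχ u φ χ ^ 2

/-- The density of the conserved energy. -/
def conserved (u : ℝ → ℝ → ℝ) (φ χ : ℝ) : ℝ :=
  S.n χ ^ 2 / S.c χ * (pφ u φ χ * pφ u φ χ) + S.lin u φ χ * S.lin u φ χ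
    - S.V χ / S.c χ * (u φ χ * u φ χ)

/-- The flux of the conserved energy. -/
def energyFlux (u : ℝ → ℝ → ℝ) (φ χ : ℝ) : ℝ :=
  2 * (S.r χ ^ 2 / S.s χ * (S.lin u φ χ * pφ u φ χ))

/-- The null form whose `χ`-derivative relates the conserved energy to the density. -/
def boundaryForm (u : ℝ → ℝ → ℝ) (φ χ : ℝ) : ℝ :=
  S.r χ ^ 2 / S.s χ * S.p χ * (u φ χ * u φ χ)

variable {S} {φ χ θ : ℝ} {u : ℝ → ℝ → ℝ}

lemma density_nonneg : 0 ≤ S.density u φ χ := by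
  unfold density; positivity

namespace IsSmall

/-- Here r₀²/s = 4π r₀² n / √c has logarithmic r₀-derivative 2/r₀ - q + h/c, and the prefactor
cancels against ∂_χ r₀. -/
lemma hasDerivWithinAt_inv_drdχ (hχ : χ ∈ Ioc 0 S.B) :
    HasDerivWithinAt (fun χ => S.r χ ^ 2 / S.s χ) (S.p χ + S.h χ / S.c χ) (Ioc 0 S.B) χ := by
  have hr := r_ne hχ
  have hc := c_pos hχ
  have hc' := (Real.sqrt_pos.2 hc).ne'
  have hn := (n_pos hχ).ne'
  have hpi := Real.pi_pos.ne'
  have h1 := ((hasDerivWithinAt_r hχ).pow 2).div (((hasDerivWithinAt_c hχ).sqrt hc.ne').div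
    ((hasDerivWithinAt_n hχ).const_mul (4 * Real.pi)) (by positivity)) (s_pos hχ).ne'
  refine h1.congr_deriv ?_
  have hs := (s_pos hχ).ne'
  have e : √(S.c χ) = 4 * Real.pi * S.n χ * S.s χ := by unfold s; field_simp
  have e2 : S.c χ = (4 * Real.pi * S.n χ * S.s χ) ^ 2 := by rw [← e, Real.sq_sqrt hc.le]
  simp only [p, Pi.pow_apply, Pi.div_apply, e]
  rw [e2]
  push_cast
  field_simp
  ring

variable (hS : S.IsSmall)
include hS

lemma smooth_conserved (hu : S.Smooth u) : S.Smooth (S.conserved u) := by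
  have hc : ∀ χ ∈ Ioc 0 S.B, S.c χ ≠ 0 := fun χ hχ => (c_pos hχ).ne'
  have hl := hS.smooth_lin hu
  have h1 := (((hS.isSymbol_n.contDiffOn hS).pow 2).div (hS.isSymbol_c.contDiffOn hS) hc)
  have h2 := ((hS.isSymbol_V.contDiffOn hS).div (hS.isSymbol_c.contDiffOn hS) hc).neg
  exact ((((hu.deriv_φ.mul hu.deriv_φ).smul h1).add (hl.mul hl)).add
    ((hu.mul hu).smul h2)).congr fun φ _ χ _ => by
      simp only [conserved, Pi.div_apply]; ring

lemma smooth_energyFlux (hu : S.Smooth u) : S.Smooth (S.energyFlux u) :=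
  (((hS.smooth_lin hu).mul hu.deriv_φ).smul hS.contDiffOn_inv_drdχ).smul
    (a := fun _ => 2) contDiffOn_const

lemma smooth_boundaryForm (hu : S.Smooth u) : S.Smooth (S.boundaryForm u) :=
  (hu.mul hu).smul (hS.contDiffOn_inv_drdχ.mul hS.contDiffOn_p)

/-- The energy identity in differential form. -/
lemma pφ_conserved (hu : S.IsWave θ u) (hφ : 0 ≤ φ) (hχ : χ ∈ Ioc 0 S.B) :
    pφ (S.conserved u) φ χ = S.pχ (S.energyFlux u) φ χ := by
  have hl := hS.smooth_lin hu.smooth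
  have hc := (c_pos hχ).ne'
  have hs := (s_pos hχ).ne'
  have a1 := hu.smooth.deriv_φ.hasDeriv_φ hφ hχ
  have a2 := hl.hasDeriv_φ hφ hχ
  have a3 := hu.smooth.hasDeriv_φ hφ hχ
  have h1 := pφ_of_hasDeriv (f := S.conserved u) hφ
    ((((a1.mul a1).const_mul (S.n χ ^ 2 / S.c χ)).add (a2.mul a2)).sub
    ((a3.mul a3).const_mul (S.V χ / S.c χ)))
  have h2 := pχ_of_hasDeriv (f := S.energyFlux u) (φ := φ) hχ (((hasDerivWithinAt_inv_drdχ hχ).mul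
    ((hl.hasDeriv_χ hφ hχ).mul (hu.smooth.deriv_φ.hasDeriv_χ hφ hχ))).const_mul 2)
  have h3 := hu.wave φ hφ χ hχ
  rw [h1, h2, lin_pφ hu.smooth hφ hχ]
  have h4 : S.lin (pφ u) φ χ = S.r χ ^ 2 / S.s χ * S.pχ (pφ u) φ χ + S.p χ * pφ u φ χ := rfl
  have h5 : S.n χ ^ 2 / S.c χ * pφ (pφ u) φ χ = S.r χ ^ 2 / S.s χ * S.pχ (S.lin u) φ χ
      + S.h χ / S.c χ * S.lin u φ χ + S.V χ / S.c χ * u φ χ := by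
    rw [div_mul_eq_mul_div, h3]; field_simp
  rw [h4]
  simp only [Pi.mul_apply]
  -- The multiplier is 2∂_φu. The terms with p and h/c from differentiating the flux weight complete
  -- D∂_φu to `lin` (∂_φu) and D(`lin` u) to the right side of the equation.
  linear_combination 2 * pφ u φ χ * h5

/-- Pointwise coercivity up to a divergence. -/
lemma density_add_le (hu : S.Smooth u) (hφ : 0 ≤ φ) (hχ : χ ∈ Ioc 0 S.B) :
    S.density u φ χ + S.pχ (S.boundaryForm u) φ χ ≤ S.conserved u φ χ := by
  have hr := S.r_pos χ hχ
  have hc := c_pos hχ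
  have hs := s_pos hχ
  have a3 := hu.hasDeriv_χ hφ hχ
  have h1 := pχ_of_hasDeriv (f := S.boundaryForm u) (φ := φ) hχ
    (((hasDerivWithinAt_inv_drdχ hχ).mul
      (((hasDerivWithinAt_const χ _ (2 : ℝ)).div (hasDerivWithinAt_r hχ) hr.ne').sub
        (hasDerivWithinAt_q hχ))).mul (a3.mul a3))
  have h2 := hS.coercive_coeff hχ
  set Dq := (4 * Real.pi * S.rho χ - 2 * S.mu χ + 4 * Real.pi * (S.rho χ - 1)
        - 4 * Real.pi * S.r χ * (S.n χ ^ 2 * S.q χ)) / S.c χ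
        + 2 * S.q χ * S.h χ / S.c χ with hDq
  have h3 : 1 ≤ S.n χ ^ 2 / S.c χ := by
    rw [le_div_iff₀ hc]
    nlinarith [one_le_n hχ, c_le hχ]
  have h4 : S.r χ ^ 4 * S.pχ u φ χ ^ 2 ≤ (S.r χ ^ 2 / S.s χ * S.pχ u φ χ) ^ 2 := by
    have e : (S.r χ ^ 2 / S.s χ * S.pχ u φ χ) ^ 2
        = S.r χ ^ 4 * S.pχ u φ χ ^ 2 / S.s χ ^ 2 := by field_simp
    rw [e, le_div_iff₀ (by positivity)]
    have : S.s χ ^ 2 ≤ 1 := pow_le_one₀ hs.le (s_le hχ)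
    exact mul_le_of_le_one_right (by positivity) this
  have h5 := mul_le_mul_of_nonneg_right h2 (sq_nonneg (u φ χ))
  have h6 := mul_le_mul_of_nonneg_right h3 (sq_nonneg (pφ u φ χ))
  -- Both the cross term 2pu Du and p²u² appear in (`lin` u)² too. They cancel in the difference,
  -- leaving (Du)² and the coefficient of u² bounded below by `coercive_coeff`.
  have e1 : S.pχ (S.boundaryForm u) φ χ =
      (S.p χ * (S.p χ + S.h χ / S.c χ) - 2 / S.r χ ^ 2 - Dq) * u φ χ ^ 2
      + 2 * S.p χ * u φ χ * (S.r χ ^ 2 / S.s χ * S.pχ u φ χ) := by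
    rw [h1]
    simp only [p, Pi.mul_apply, Pi.sub_apply, Pi.div_apply]
    field_simp
    ring
  rw [e1, density, conserved, lin]
  set w := S.r χ ^ 2 / S.s χ * S.pχ u φ χ
  have e2 : u φ χ ^ 2 / S.r χ ^ 2 = 1 / S.r χ ^ 2 * u φ χ ^ 2 := by ring
  rw [e2]
  have e3 : S.p χ * (S.p χ + S.h χ / S.c χ) = S.p χ ^ 2 + S.p χ * S.h χ / S.c χ := by ring
  rw [e3]
  nlinarith

/-- The constant is 2 · 100², from (a + b)² ≤ 2a² + 2b² and s ≥ 1/100; the term pu only needs p ≤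
2/r₀. -/
lemma lin_sq_le (hχ : χ ∈ Ioc 0 S.B) :
    S.lin u φ χ ^ 2 ≤ 20000 * (u φ χ ^ 2 / S.r χ ^ 2 + S.r χ ^ 4 * S.pχ u φ χ ^ 2) := by
  have hr := S.r_pos χ hχ
  have hs := s_pos hχ
  have h4 : (S.r χ ^ 2 / S.s χ * S.pχ u φ χ) ^ 2 ≤ 10000 * (S.r χ ^ 4 * S.pχ u φ χ ^ 2) := by
    have e : (S.r χ ^ 2 / S.s χ * S.pχ u φ χ) ^ 2
        = S.r χ ^ 4 * S.pχ u φ χ ^ 2 / S.s χ ^ 2 := by field_simp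
    rw [e, div_le_iff₀ (by positivity)]
    have : 1 ≤ 10000 * S.s χ ^ 2 := by nlinarith [hS.s_ge hχ]
    have h0 : 0 ≤ S.r χ ^ 4 * S.pχ u φ χ ^ 2 := by positivity
    nlinarith
  have h5 : (S.p χ * u φ χ) ^ 2 ≤ 4 * (u φ χ ^ 2 / S.r χ ^ 2) := by
    have h1 : S.p χ ^ 2 ≤ (2 / S.r χ) ^ 2 := pow_le_pow_left₀ (hS.p_pos hχ).le (p_le hχ) 2
    calc (S.p χ * u φ χ) ^ 2 = S.p χ ^ 2 * u φ χ ^ 2 := by ring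
      _ ≤ (2 / S.r χ) ^ 2 * u φ χ ^ 2 := by gcongr
      _ = _ := by ring
  have h7 : 0 ≤ u φ χ ^ 2 / S.r χ ^ 2 := by positivity
  rw [lin]
  nlinarith [sq_nonneg (S.r χ ^ 2 / S.s χ * S.pχ u φ χ - S.p χ * u φ χ)]

/-- The conserved density is controlled by the density of the energy. -/
lemma conserved_le (hχ : χ ∈ Ioc 0 S.B) :
    S.conserved u φ χ ≤ 20000 * S.density u φ χ := by
  have hc := c_pos hχ
  have hV : 0 ≤ S.V χ / S.c χ * (u φ χ * u φ χ) :=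
    mul_nonneg (div_nonneg (V_nonneg hχ) hc.le) (mul_self_nonneg _)
  have h3 : S.n χ ^ 2 / S.c χ ≤ 2 := by
    rw [div_le_iff₀ hc]
    linarith [hS.n_sq_le hχ, hS.c_ge hχ]
  have h6 := mul_le_mul_of_nonneg_right h3 (sq_nonneg (pφ u φ χ))
  have h8 : 0 ≤ pφ u φ χ ^ 2 := sq_nonneg _
  have h4 := hS.lin_sq_le (u := u) (φ := φ) hχ
  rw [density, conserved]
  nlinarith

end IsSmall
end StaticHardStar

/-! ### The integrated energy inequality and the limit at the centre. -/

namespace StaticHardStar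

variable {S : StaticHardStar} {φ χ θ T δ : ℝ} {f g u : ℝ → ℝ → ℝ}

namespace Smooth

lemma hasFDerivAt (hf : S.Smooth f) {x : ℝ × ℝ} (h1 : 0 < x.1) (h2 : x.2 ∈ Ioo 0 S.B) :
    HasFDerivAt (fun p : ℝ × ℝ => f p.1 p.2)
      (fderivWithin ℝ (fun p : ℝ × ℝ => f p.1 p.2) S.domain x) x :=
  (hf.hasFDerivWithinAt h1.le (Ioo_sub h2)).hasFDerivAt
    (prod_mem_nhds (Ici_mem_nhds h1) (Ioc_mem_nhds h2.1 h2.2))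

lemma continuousOn_left (hf : S.Smooth f) (hχ : χ ∈ Ioc 0 S.B) :
    ContinuousOn (fun φ => f φ χ) (Ici 0) :=
  fun _ hφ => (hf.hasDeriv_φ hφ hχ).continuousWithinAt

lemma intervalIntegrable_left (hf : S.Smooth f) (hT : 0 ≤ T) (hχ : χ ∈ Ioc 0 S.B) :
    IntervalIntegrable (fun φ => f φ χ) volume 0 T := by
  refine ContinuousOn.intervalIntegrable ((hf.continuousOn_left hχ).mono ?_)
  rw [uIcc_of_le hT]; exact fun x hx => hx.1

lemma intervalIntegrable_right (hf : S.Smooth f) (hφ : 0 ≤ φ) (hδ : δ ∈ Ioc 0 S.B) :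
    IntervalIntegrable (f φ) volume δ S.B := by
  refine ContinuousOn.intervalIntegrable ((hf.continuousOn_slice hφ).mono ?_)
  rw [uIcc_of_le hδ.2]; exact fun x hx => ⟨hδ.1.trans_le hx.1, hx.2⟩

lemma integral_pφ (hf : S.Smooth f) (hT : 0 ≤ T) (hχ : χ ∈ Ioc 0 S.B) :
    ∫ φ in (0 : ℝ)..T, pφ f φ χ = f T χ - f 0 χ := by
  refine intervalIntegral.integral_eq_sub_of_hasDerivAt_of_le hT
    ((hf.continuousOn_left hχ).mono fun x hx => hx.1) (fun x hx => ?_)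
    (hf.deriv_φ.intervalIntegrable_left hT hχ)
  exact (hf.hasDeriv_φ hx.1.le hχ).hasDerivAt (Ici_mem_nhds hx.1)

lemma integral_pχ (hf : S.Smooth f) (hφ : 0 ≤ φ) (hδ : δ ∈ Ioc 0 S.B) :
    ∫ χ in δ..S.B, S.pχ f φ χ = f φ S.B - f φ δ := by
  refine intervalIntegral.integral_eq_sub_of_hasDerivAt_of_le hδ.2
    ((hf.continuousOn_slice hφ).mono fun x hx => ⟨hδ.1.trans_le hx.1, hx.2⟩) (fun x hx => ?_)
    (hf.deriv_χ.intervalIntegrable_right hφ hδ)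
  have hx0 := hδ.1.trans hx.1
  exact (hf.hasDeriv_χ hφ ⟨hx0, hx.2.le⟩).hasDerivAt (Ioc_mem_nhds hx0 hx.2)

/-- A conservation law `∂_φ f = ∂_χ g` in integrated form. -/
lemma integral_conservation (hf : S.Smooth f) (hg : S.Smooth g)
    (hfg : ∀ φ, 0 ≤ φ → ∀ χ ∈ Ioc 0 S.B, pφ f φ χ = S.pχ g φ χ) (hT : 0 ≤ T)
    (hδ : δ ∈ Ioc 0 S.B) :
    ∫ χ in δ..S.B, f T χ = (∫ χ in δ..S.B, f 0 χ) + (∫ φ in (0 : ℝ)..T, g φ S.B)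
      - ∫ φ in (0 : ℝ)..T, g φ δ := by
  have hsub : uIcc 0 T ×ˢ uIcc δ S.B ⊆ S.domain := by
    rw [uIcc_of_le hT, uIcc_of_le hδ.2]
    exact fun x hx => ⟨hx.1.1, hδ.1.trans_le hx.2.1, hx.2.2⟩
  have h0 : ∀ x ∈ uIcc 0 T ×ˢ uIcc δ S.B,
      fderivWithin ℝ (fun p : ℝ × ℝ => f p.1 p.2) S.domain x (1, 0)
        + (-fderivWithin ℝ (fun p : ℝ × ℝ => g p.1 p.2) S.domain x) (0, 1) = 0 := by
    intro x hx
    have hx := hsub hx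
    rw [_root_.neg_apply, ← hf.pφ_eq hx.1 hx.2, ← hg.pχ_eq hx.1 hx.2,
      hfg x.1 hx.1 x.2 hx.2, add_neg_cancel]
  -- Divergence theorem for the field (f, -g) on [0, T] × [δ, B], which stays away from the centre.
  have key := integral2_divergence_prod_of_hasFDerivAt (fun p : ℝ × ℝ => f p.1 p.2)
    (fun p : ℝ × ℝ => -g p.1 p.2)
    (fderivWithin ℝ (fun p : ℝ × ℝ => f p.1 p.2) S.domain)
    (fun x => -fderivWithin ℝ (fun p : ℝ × ℝ => g p.1 p.2) S.domain x) 0 δ T S.B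
    ((ContDiffOn.continuousOn hf).mono hsub) ((ContDiffOn.continuousOn hg).neg.mono hsub)
    (fun x hx => by
      rw [min_eq_left hT, max_eq_right hT, min_eq_left hδ.2, max_eq_right hδ.2] at hx
      exact hf.hasFDerivAt hx.1.1 ⟨hδ.1.trans hx.2.1, hx.2.2⟩)
    (fun x hx => by
      rw [min_eq_left hT, max_eq_right hT, min_eq_left hδ.2, max_eq_right hδ.2] at hx
      exact (hg.hasFDerivAt hx.1.1 ⟨hδ.1.trans hx.2.1, hx.2.2⟩).neg)
    (integrableOn_zero.congr_fun (fun x hx => (h0 x hx).symm)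
      (measurableSet_uIcc.prod measurableSet_uIcc))
  have hL : (∫ x in (0 : ℝ)..T, ∫ y in δ..S.B,
      fderivWithin ℝ (fun p : ℝ × ℝ => f p.1 p.2) S.domain (x, y) (1, 0)
        + (-fderivWithin ℝ (fun p : ℝ × ℝ => g p.1 p.2) S.domain (x, y)) (0, 1)) = 0 := by
    rw [intervalIntegral.integral_congr (g := fun _ => (0 : ℝ)) fun x hx => ?_]
    · simp
    · simp only
      rw [intervalIntegral.integral_congr (g := fun _ => (0 : ℝ)) fun y hy => h0 (x, y) ⟨hx, hy⟩]
      simp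
  rw [hL] at key
  simp only [intervalIntegral.integral_neg] at key
  linarith

end Smooth

namespace IsWave

lemma smooth_density (hS : S.IsSmall) (hu : S.Smooth u) : S.Smooth (S.density u) := by
  have hr := hS.isSymbol_r.contDiffOn hS
  exact ((((hu.mul hu).smul ((hr.pow 2).inv fun χ hχ => pow_ne_zero 2 (r_ne hχ))).add
    (hu.deriv_φ.mul hu.deriv_φ)).add ((hu.deriv_χ.mul hu.deriv_χ).smul (hr.pow 4))).congr
    fun φ _ χ _ => by simp only [density, Pi.inv_apply]; ring

/-- With `lin` u = θpu at B, the flux 2(r₀²/s) `lin` u ∂_φu is the exact φ-derivative of θ times the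
boundary form. -/
lemma integral_flux_boundary (hS : S.IsSmall) (hu : S.IsWave θ u) (hT : 0 ≤ T) :
    ∫ φ in (0 : ℝ)..T, S.energyFlux u φ S.B
      = θ * (S.boundaryForm u T S.B - S.boundaryForm u 0 S.B) := by
  have hN := hS.smooth_boundaryForm hu.smooth
  rw [← hN.integral_pφ hT right_mem, ← intervalIntegral.integral_const_mul]
  refine intervalIntegral.integral_congr fun φ hφ => ?_
  rw [uIcc_of_le hT] at hφ
  have h1 := hu.smooth.hasDeriv_φ hφ.1 (right_mem (S := S))
  have h2 := pφ_of_hasDeriv (f := S.boundaryForm u) hφ.1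
    ((h1.mul h1).const_mul (S.r S.B ^ 2 / S.s S.B * S.p S.B))
  simp only [h2, energyFlux, hu.boundary φ hφ.1]
  ring

lemma boundaryForm_nonneg (hS : S.IsSmall) (hχ : χ ∈ Ioc 0 S.B) : 0 ≤ S.boundaryForm u φ χ := by
  have := s_pos hχ
  have := hS.p_pos hχ
  have := mul_self_nonneg (u φ χ)
  unfold boundaryForm; positivity

lemma inv_drdχ_le (hS : S.IsSmall) (hχ : χ ∈ Ioc 0 S.B) :
    S.r χ ^ 2 / S.s χ ≤ 100 * S.r χ ^ 2 := by
  rw [div_le_iff₀ (s_pos hχ)]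
  nlinarith [hS.s_ge hχ, sq_nonneg (S.r χ)]

/-- The energy inequality on `[δ, B]`, up to an error from the centre. -/
lemma integral_density_le (hS : S.IsSmall) (hu : S.IsWave θ u) (h0 : 0 ≤ θ) (h1 : θ ≤ 1)
    (hT : 0 ≤ T) : ∃ K, ∀ δ ∈ Ioc 0 S.B, ∫ χ in δ..S.B, S.density u T χ ≤
      20000 * (∫ χ in δ..S.B, S.density u 0 χ) + K * S.r δ := by
  obtain ⟨K, hK⟩ := hu.linear_bound hS T
  obtain ⟨K', hK'⟩ := (hu.deriv_φ hS).bounded T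
  refine ⟨200 * K ^ 2 + T * (200 * (K * K')), fun δ hδ => ?_⟩
  have hTm : T ∈ Icc 0 T := right_mem_Icc.2 hT
  have k0 : 0 ≤ K := (abs_nonneg _).trans (hK T hTm δ hδ).1
  have k0' : 0 ≤ K' := (abs_nonneg _).trans (hK' T hTm δ hδ)
  have hN := hS.smooth_boundaryForm hu.smooth
  have hC := hS.smooth_conserved hu.smooth
  have hD := smooth_density hS hu.smooth
  have hr := S.r_pos δ hδ
  have hr1 : S.r δ ≤ 1 := by linarith [hS.r_lt hδ]
  have hw := inv_drdχ_le hS hδ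
  have hw0 : 0 ≤ S.r δ ^ 2 / S.s δ := by have := s_pos hδ; positivity
  have a1 := hC.integral_conservation (hS.smooth_energyFlux hu.smooth)
    (fun φ hφ χ hχ => hS.pφ_conserved hu hφ hχ) hT hδ
  rw [hu.integral_flux_boundary hS hT] at a1
  have a2 : (∫ χ in δ..S.B, S.density u T χ) + ∫ χ in δ..S.B, S.pχ (S.boundaryForm u) T χ
      ≤ ∫ χ in δ..S.B, S.conserved u T χ := by
    rw [← intervalIntegral.integral_add (hD.intervalIntegrable_right hT hδ)
      (hN.deriv_χ.intervalIntegrable_right hT hδ)]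
    refine intervalIntegral.integral_mono_on hδ.2 ((hD.intervalIntegrable_right hT hδ).add
      (hN.deriv_χ.intervalIntegrable_right hT hδ)) (hC.intervalIntegrable_right hT hδ)
      fun χ hχ => hS.density_add_le hu.smooth hT ⟨hδ.1.trans_le hχ.1, hχ.2⟩
  rw [hN.integral_pχ hT hδ] at a2
  have a3 : ∫ χ in δ..S.B, S.conserved u 0 χ ≤ 20000 * ∫ χ in δ..S.B, S.density u 0 χ := by
    rw [← intervalIntegral.integral_const_mul]
    exact intervalIntegral.integral_mono_on hδ.2 (hC.intervalIntegrable_right le_rfl hδ)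
      ((hD.intervalIntegrable_right le_rfl hδ).const_mul _)
      fun χ hχ => hS.conserved_le ⟨hδ.1.trans_le hχ.1, hχ.2⟩
  have a4 : |∫ φ in (0 : ℝ)..T, S.energyFlux u φ δ| ≤ 200 * (K * K') * S.r δ * |T - 0| := by
    refine intervalIntegral.norm_integral_le_of_norm_le_const (f := fun φ => S.energyFlux u φ δ)
      fun φ hφ => ?_
    rw [uIoc_of_le hT] at hφ
    have hφ' : φ ∈ Icc 0 T := ⟨hφ.1.le, hφ.2⟩
    rw [Real.norm_eq_abs, energyFlux, abs_mul, abs_mul, abs_mul, abs_of_nonneg hw0, abs_two]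
    calc 2 * (S.r δ ^ 2 / S.s δ * (|S.lin u φ δ| * |pφ u φ δ|))
        ≤ 2 * (100 * S.r δ ^ 2 * (K * K')) := by
          gcongr
          · exact (hK φ hφ' δ hδ).1
          · exact hK' φ hφ' δ hδ
      _ = 200 * (K * K') * S.r δ * S.r δ := by ring
      _ ≤ 200 * (K * K') * S.r δ * 1 := by gcongr
      _ = 200 * (K * K') * S.r δ := mul_one _
  rw [sub_zero, abs_of_nonneg hT] at a4
  have a5 : S.boundaryForm u T δ ≤ 200 * K ^ 2 * S.r δ := by
    have hu2 : u T δ * u T δ ≤ (K * S.r δ) ^ 2 := by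
      rw [← sq, ← sq_abs]
      exact pow_le_pow_left₀ (abs_nonneg _) (hK T hTm δ hδ).2 2
    calc S.boundaryForm u T δ ≤ 100 * S.r δ ^ 2 * (2 / S.r δ) * (K * S.r δ) ^ 2 := by
          unfold boundaryForm
          gcongr
          · exact mul_self_nonneg _
          · exact (hS.p_pos hδ).le
          · exact IsSmall.p_le hδ
      _ = 200 * K ^ 2 * S.r δ * S.r δ ^ 2 := by field_simp; ring
      _ ≤ 200 * K ^ 2 * S.r δ * 1 := by gcongr; exact pow_le_one₀ hr.le hr1
      _ = 200 * K ^ 2 * S.r δ := mul_one _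
  have a6 := (abs_le.1 a4).1
  have b1 := boundaryForm_nonneg (u := u) (φ := T) hS (right_mem (S := S))
  have b2 := boundaryForm_nonneg (u := u) (φ := 0) hS (right_mem (S := S))
  -- The range of θ is used here: θN(T, B) ≤ N(T, B) is absorbed by the divergence term on the left,
  -- and -θN(0, B) ≤ 0 is dropped.
  nlinarith [mul_nonneg h0 b2, mul_le_of_le_one_left b1 h1]

/-- The bound |u| ≤ K r₀ handles u/r₀, and r₀²∂_χu = s(`lin` u - pu) is bounded because p ≤ 2/r₀.
Finiteness of the energy follows. -/
lemma density_bounded (hS : S.IsSmall) (hu : S.IsWave θ u) (T : ℝ) :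
    ∃ K, ∀ φ ∈ Icc 0 T, ∀ χ ∈ Ioc 0 S.B, S.density u φ χ ≤ K := by
  obtain ⟨K, hK⟩ := hu.linear_bound hS T
  obtain ⟨K', hK'⟩ := (hu.deriv_φ hS).bounded T
  refine ⟨K ^ 2 + K' ^ 2 + (K + 2 * K) ^ 2, fun φ hφ χ hχ => ?_⟩
  obtain ⟨h1, h2⟩ := hK φ hφ χ hχ
  have hr := S.r_pos χ hχ
  have hs := s_pos hχ
  have k0 : 0 ≤ K := (abs_nonneg _).trans h1
  unfold density
  gcongr ?_ + ?_ + ?_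
  · rw [div_le_iff₀ (by positivity), ← sq_abs, ← mul_pow]
    exact pow_le_pow_left₀ (abs_nonneg _) h2 2
  · rw [← sq_abs]
    exact pow_le_pow_left₀ (abs_nonneg _) (hK' φ hφ χ hχ) 2
  · have e : S.r χ ^ 4 * S.pχ u φ χ ^ 2
        = |S.s χ * (S.lin u φ χ - S.p χ * u φ χ)| ^ 2 := by
      rw [sq_abs, lin]; field_simp; ring
    rw [e]
    refine pow_le_pow_left₀ (abs_nonneg _) ?_ 2
    rw [abs_mul, abs_of_pos hs]
    calc S.s χ * |S.lin u φ χ - S.p χ * u φ χ| ≤ 1 * (|S.lin u φ χ| + |S.p χ * u φ χ|) := by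
          gcongr
          · exact IsSmall.s_le hχ
          · exact abs_sub _ _
      _ ≤ 1 * (K + 2 * K) := by
          gcongr
          rw [abs_mul, abs_of_pos (hS.p_pos hχ)]
          calc S.p χ * |u φ χ| ≤ 2 / S.r χ * (K * S.r χ) := by
                gcongr; exact IsSmall.p_le hχ
            _ = 2 * K := by field_simp
      _ = K + 2 * K := one_mul _

lemma integrableOn_density (hS : S.IsSmall) (hu : S.IsWave θ u) (hφ : 0 ≤ φ) :
    IntegrableOn (S.density u φ) (Ioc 0 S.B) := by
  obtain ⟨K, hK⟩ := hu.density_bounded hS φ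
  refine Integrable.of_bound
    (((smooth_density hS hu.smooth).continuousOn_slice hφ).aestronglyMeasurable
      measurableSet_Ioc) K ?_
  filter_upwards [ae_restrict_mem measurableSet_Ioc] with χ hχ
  rw [Real.norm_eq_abs, abs_of_nonneg density_nonneg]
  exact hK φ ⟨hφ, le_rfl⟩ χ hχ

lemma setIntegral_density_le (hS : S.IsSmall) (hu : S.IsWave θ u) (h0 : 0 ≤ θ) (h1 : θ ≤ 1)
    (hT : 0 ≤ T) : ∫ χ in Ioc 0 S.B, S.density u T χ ≤
      20000 * ∫ χ in Ioc 0 S.B, S.density u 0 χ := by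
  obtain ⟨K, hK⟩ := hu.integral_density_le hS h0 h1 hT
  obtain ⟨M, hM⟩ := hu.density_bounded hS T
  have hi : ∀ φ, 0 ≤ φ → IntervalIntegrable (S.density u φ) volume 0 S.B := fun φ hφ =>
    (intervalIntegrable_iff_integrableOn_Ioc_of_le S.B_pos.le).2 (hu.integrableOn_density hS hφ)
  rw [← intervalIntegral.integral_of_le S.B_pos.le, ← intervalIntegral.integral_of_le S.B_pos.le]
  -- The term K r₀(δ) is the error of the energy inequality at the inner end, and M δ bounds the
  -- energy in (0, δ] at time T; both vanish as δ → 0.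
  have hev : ∀ᶠ δ in 𝓝[Ioc 0 S.B] 0, ∫ χ in (0 : ℝ)..S.B, S.density u T χ ≤
      20000 * (∫ χ in (0 : ℝ)..S.B, S.density u 0 χ) + K * S.r δ + M * δ := by
    filter_upwards [self_mem_nhdsWithin] with δ hδ
    have hsub1 : uIcc 0 δ ⊆ uIcc 0 S.B := by
      rw [uIcc_of_le hδ.1.le, uIcc_of_le S.B_pos.le]; exact Icc_subset_Icc_right hδ.2
    have hsub2 : uIcc δ S.B ⊆ uIcc 0 S.B := by
      rw [uIcc_of_le hδ.2, uIcc_of_le S.B_pos.le]; exact Icc_subset_Icc_left hδ.1.le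
    have e : ∀ φ, 0 ≤ φ → (∫ χ in (0 : ℝ)..δ, S.density u φ χ) + ∫ χ in δ..S.B, S.density u φ χ
        = ∫ χ in (0 : ℝ)..S.B, S.density u φ χ := fun φ hφ =>
      intervalIntegral.integral_add_adjacent_intervals ((hi φ hφ).mono_set hsub1)
        ((hi φ hφ).mono_set hsub2)
    have e1 : ∫ χ in (0 : ℝ)..δ, S.density u T χ ≤ M * δ := by
      have := intervalIntegral.norm_integral_le_of_norm_le_const (a := 0) (b := δ)
        (f := S.density u T) (C := M) fun χ hχ => by
          rw [uIoc_of_le hδ.1.le] at hχ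
          rw [Real.norm_eq_abs, abs_of_nonneg density_nonneg]
          exact hM T ⟨hT, le_rfl⟩ χ ⟨hχ.1, hχ.2.trans hδ.2⟩
      rw [sub_zero, abs_of_pos hδ.1] at this
      exact (le_abs_self _).trans this
    have e2 : 0 ≤ ∫ χ in (0 : ℝ)..δ, S.density u 0 χ :=
      intervalIntegral.integral_nonneg hδ.1.le fun _ _ => density_nonneg
    have := hK δ hδ
    have := e T hT
    have := e 0 le_rfl
    linarith
  have hr : Tendsto S.r (𝓝[Ioc 0 S.B] 0) (𝓝 0) := by
    have := S.continuousOn_r 0 left_mem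
    rw [ContinuousWithinAt, S.r_zero] at this
    exact this.mono_left (nhdsWithin_mono 0 Ioc_sub)
  have hid : Tendsto (fun δ : ℝ => δ) (𝓝[Ioc 0 S.B] 0) (𝓝 0) :=
    tendsto_id.mono_left nhdsWithin_le_nhds
  have hlim := ((hr.const_mul K).const_add
    (20000 * ∫ χ in (0 : ℝ)..S.B, S.density u 0 χ)).add (hid.const_mul M)
  rw [mul_zero, mul_zero, add_zero, add_zero] at hlim
  exact ge_of_tendsto hlim hev

lemma energy_eq (hS : S.IsSmall) (hu : S.IsWave θ u) (hφ : 0 ≤ φ) :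
    S.energy u φ = ENNReal.ofReal (∫ χ in Ioc 0 S.B, S.density u φ χ) :=
  (ofReal_integral_eq_lintegral_ofReal (hu.integrableOn_density hS hφ)
    (Eventually.of_forall fun _ => density_nonneg)).symm

/-- The energy at any time is controlled by the (finite) initial energy. -/
theorem energy_le (hS : S.IsSmall) (hu : S.IsWave θ u) (h0 : 0 ≤ θ) (h1 : θ ≤ 1)
    (hφ : 0 ≤ φ) : S.energy u φ ≤ ENNReal.ofReal 20000 * S.energy u 0 := by
  rw [hu.energy_eq hS hφ, hu.energy_eq hS le_rfl, ← ENNReal.ofReal_mul (by norm_num)]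
  exact ENNReal.ofReal_le_ofReal (hu.setIntegral_density_le hS h0 h1 hφ)

lemma energy_lt_top (hS : S.IsSmall) (hu : S.IsWave θ u) : S.energy u 0 < ⊤ := by
  rw [hu.energy_eq hS le_rfl]; exact ENNReal.ofReal_lt_top

end IsWave
end StaticHardStar

/-! ### Higher derivatives: trading r₀³∂_χ for ∂_φ. -/

namespace StaticHardStar

variable (S : StaticHardStar)

/-- Combinations, with symbols as coefficients, of `∂_φ^l u` and `r₀ lin (∂_φ^l u)` for `l ≤ i`
and of `r₀ ∂_φ^(i+1) u`.  The energies of order `i` control these functions. -/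
inductive IsControlled : ℕ → ((ℝ → ℝ → ℝ) → ℝ → ℝ → ℝ) → Prop
  | value {i l : ℕ} {a : ℝ → ℝ} (hl : l ≤ i) (ha : S.IsSymbol a) :
      IsControlled i (fun v φ χ => a χ * (pφ^[l] v) φ χ)
  | lin {i l : ℕ} {a : ℝ → ℝ} (hl : l ≤ i) (ha : S.IsSymbol a) :
      IsControlled i (fun v φ χ => a χ * (S.r χ * S.lin (pφ^[l] v) φ χ))
  | top {i : ℕ} {a : ℝ → ℝ} (ha : S.IsSymbol a) :
      IsControlled i (fun v φ χ => a χ * (S.r χ * (pφ^[i + 1] v) φ χ))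
  | add {i : ℕ} {F F' : (ℝ → ℝ → ℝ) → ℝ → ℝ → ℝ} (hF : IsControlled i F)
      (hF' : IsControlled i F') : IsControlled i (fun v φ χ => F v φ χ + F' v φ χ)

variable {S} {φ χ θ : ℝ} {u : ℝ → ℝ → ℝ} {i j : ℕ} {F : (ℝ → ℝ → ℝ) → ℝ → ℝ → ℝ}

lemma IsWave.scaled_deriv (hu : S.IsWave θ u) (hφ : 0 ≤ φ) (hχ : χ ∈ Ioc 0 S.B) :
    HasDerivWithinAt (u φ) ((S.s χ * (S.r χ * S.lin u φ χ)
      + S.s χ * (S.r χ * S.q χ + -2) * u φ χ) / S.r χ ^ 3) (Ioc 0 S.B) χ := by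
  refine (hu.smooth.hasDeriv_χ hφ hχ).congr_deriv ?_
  have := r_ne hχ
  have := (s_pos hχ).ne'
  rw [StaticHardStar.lin, p]; field_simp; ring

/-- The wave equation is solved for ∂_χ(`lin` u), so a second χ-derivative of u is exchanged for two
φ-derivatives. The spare factors of r₀ on ∂_φ²u let it be treated as a top-order term. -/
lemma IsWave.scaled_deriv_lin (hS : S.IsSmall) (hu : S.IsWave θ u) (hφ : 0 ≤ φ)
    (hχ : χ ∈ Ioc 0 S.B) :
    HasDerivWithinAt (fun χ => S.r χ * S.lin u φ χ)
      ((S.s χ * (1 + -((S.c χ)⁻¹ * (S.r χ * S.h χ))) * (S.r χ * S.lin u φ χ)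
      + -(S.s χ * (S.c χ)⁻¹ * (S.r χ * S.r χ * S.V χ)) * u φ χ
      + S.s χ * (S.c χ)⁻¹ * (S.n χ * S.n χ) * S.r χ * (S.r χ * pφ (pφ u) φ χ)) / S.r χ ^ 3)
      (Ioc 0 S.B) χ := by
  refine ((hasDerivWithinAt_r hχ).mul
    ((hS.smooth_lin hu.smooth).hasDeriv_χ hφ hχ)).congr_deriv ?_
  have h1 := hu.wave φ hφ χ hχ
  have hr := r_ne hχ
  have hs := (s_pos hχ).ne'
  have hc := (c_pos hχ).ne'
  have h2 : S.pχ (S.lin u) φ χ = S.s χ / S.r χ ^ 2 / S.c χ * (S.n χ ^ 2 * pφ (pφ u) φ χ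
      - S.h χ * S.lin u φ χ - S.V χ * u φ χ) := by
    rw [h1]; field_simp; ring
  rw [h2]
  field_simp
  ring

namespace IsControlled

lemma smul {a : ℝ → ℝ} (ha : S.IsSymbol a) (hF : S.IsControlled i F) :
    S.IsControlled i (fun v φ χ => a χ * F v φ χ) := by
  induction hF with
  | value hl hb => simpa only [mul_assoc] using value hl (ha.mul hb)
  | lin hl hb => simpa only [mul_assoc] using lin hl (ha.mul hb)
  | top hb => simpa only [mul_assoc] using top (ha.mul hb)
  | add _ _ ih ih' => simpa only [mul_add] using ih.add ih'

lemma succ (hS : S.IsSmall) (hF : S.IsControlled i F) : S.IsControlled (i + 1) F := by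
  induction hF with
  | value hl hb => exact value (Nat.le_succ_of_le hl) hb
  | lin hl hb => exact lin (Nat.le_succ_of_le hl) hb
  | top hb => simpa only [mul_assoc] using value le_rfl (hb.mul hS.isSymbol_r)
  | add _ _ ih ih' => exact ih.add ih'

lemma of_le (hS : S.IsSmall) (hF : S.IsControlled i F) (hij : i ≤ j) : S.IsControlled j F :=
  Nat.le_induction hF (fun _ _ ih => ih.succ hS) j hij

/-- `r₀³ ∂_χ` of the basic quantity of order `l`. -/
lemma scaled_deriv_value (hS : S.IsSmall) {l : ℕ} (hl : l ≤ i) {a : ℝ → ℝ} (ha : S.IsSymbol a) :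
    ∃ F', S.IsControlled i F' ∧ ∀ θ u, S.IsWave θ u → ∀ φ, 0 ≤ φ → ∀ χ ∈ Ioc 0 S.B,
      HasDerivWithinAt (fun χ => a χ * (pφ^[l] u) φ χ) (F' u φ χ / S.r χ ^ 3) (Ioc 0 S.B) χ := by
  refine ⟨_, ((value hl ha.scaled_deriv).add (lin hl (ha.mul hS.isSymbol_s))).add
    (value hl (ha.mul (hS.isSymbol_s.mul ((hS.isSymbol_r.mul hS.isSymbol_q).add
      (IsSymbol.const (-2)))))), fun θ u hu φ hφ χ hχ => ?_⟩
  refine ((ha.hasDeriv hχ).mul ((hu.pφ_iterate hS l).scaled_deriv hφ hχ)).congr_deriv ?_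
  have := r_ne hχ
  field_simp
  ring

lemma scaled_deriv_lin (hS : S.IsSmall) {l : ℕ} (hl : l ≤ i) {a : ℝ → ℝ} (ha : S.IsSymbol a) :
    ∃ F', S.IsControlled (i + 1) F' ∧ ∀ θ u, S.IsWave θ u → ∀ φ, 0 ≤ φ → ∀ χ ∈ Ioc 0 S.B,
      HasDerivWithinAt (fun χ => a χ * (S.r χ * S.lin (pφ^[l] u) φ χ))
        (F' u φ χ / S.r χ ^ 3) (Ioc 0 S.B) χ := by
  have hs := hS.isSymbol_s
  have hr := hS.isSymbol_r
  have hsc := hs.mul hS.isSymbol_inv_c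
  -- The term in ∂_φ^(l+2)u is of type `top` at order l + 1 ≤ i + 1. This is why `IsControlled`
  -- admits r₀ ∂_φ^(i+1)u: the order rises by one, not two.
  refine ⟨_, ((((lin hl ha.scaled_deriv).add (lin hl (ha.mul (hs.mul ((IsSymbol.const 1).add
    (hS.isSymbol_inv_c.mul (hr.mul hS.isSymbol_h)).neg))))).add
    (value hl (ha.mul (hsc.mul ((hr.mul hr).mul hS.isSymbol_V)).neg))).succ hS).add
    ((top (i := l + 1) (ha.mul ((hsc.mul (hS.isSymbol_n.mul hS.isSymbol_n)).mul hr))).of_le hS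
      (Nat.succ_le_succ hl)), fun θ u hu φ hφ χ hχ => ?_⟩
  refine ((ha.hasDeriv hχ).mul ((hu.pφ_iterate hS l).scaled_deriv_lin hS hφ hχ)).congr_deriv ?_
  have := r_ne hχ
  rw [Function.iterate_succ_apply' pφ (l + 1), Function.iterate_succ_apply' pφ l]
  field_simp
  ring

/-- The scaled derivative `r₀³ ∂_χ` raises the order by one. -/
lemma scaled_deriv (hS : S.IsSmall) (hF : S.IsControlled i F) :
    ∃ F', S.IsControlled (i + 1) F' ∧ ∀ θ u, S.IsWave θ u → ∀ φ, 0 ≤ φ → ∀ χ ∈ Ioc 0 S.B,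
      HasDerivWithinAt (F u φ) (F' u φ χ / S.r χ ^ 3) (Ioc 0 S.B) χ := by
  induction hF with
  | value hl ha => exact scaled_deriv_value hS (Nat.le_succ_of_le hl) ha
  | lin hl ha => exact scaled_deriv_lin hS hl ha
  | top ha =>
    -- At order i + 1 the top term is an ordinary value term whose symbol has absorbed r₀.
    obtain ⟨F', hF', h⟩ := scaled_deriv_value hS (le_refl _) (ha.mul hS.isSymbol_r)
    exact ⟨F', hF', by simpa only [mul_assoc] using h⟩
  | add _ _ ih ih' =>
    obtain ⟨F₁, h₁, d₁⟩ := ih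
    obtain ⟨F₂, h₂, d₂⟩ := ih'
    refine ⟨_, h₁.add h₂, fun θ u hu φ hφ χ hχ => ?_⟩
    rw [add_div]
    exact (d₁ θ u hu φ hφ χ hχ).add (d₂ θ u hu φ hφ χ hχ)

/-- The derivative `∂_φ` raises the order by one. -/
lemma deriv_φ (hS : S.IsSmall) (hF : S.IsControlled i F) :
    ∃ F', S.IsControlled (i + 1) F' ∧ ∀ θ u, S.IsWave θ u → ∀ φ, 0 ≤ φ → ∀ χ ∈ Ioc 0 S.B,
      HasDerivWithinAt (fun t => F u t χ) (F' u φ χ) (Ici 0) φ := by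
  induction hF with
  | value hl ha =>
    refine ⟨_, value (Nat.succ_le_succ hl) ha, fun θ u hu φ hφ χ hχ => ?_⟩
    rw [Function.iterate_succ_apply']
    exact ((hu.pφ_iterate hS _).smooth.hasDeriv_φ hφ hχ).const_mul _
  | @lin l _ hl ha =>
    refine ⟨_, lin (Nat.succ_le_succ hl) ha, fun θ u hu φ hφ χ hχ => ?_⟩
    have hl := (hu.pφ_iterate hS l).smooth
    rw [Function.iterate_succ_apply', ← IsSmall.lin_pφ hl hφ hχ]
    exact (((hS.smooth_lin hl).hasDeriv_φ hφ hχ).const_mul _).const_mul _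
  | top ha =>
    refine ⟨_, top ha, fun θ u hu φ hφ χ hχ => ?_⟩
    rw [Function.iterate_succ_apply']
    exact (((hu.pφ_iterate hS _).smooth.hasDeriv_φ hφ hχ).const_mul _).const_mul _
  | add _ _ ih ih' =>
    obtain ⟨F₁, h₁, d₁⟩ := ih
    obtain ⟨F₂, h₂, d₂⟩ := ih'
    exact ⟨_, h₁.add h₂, fun θ u hu φ hφ χ hχ => (d₁ θ u hu φ hφ χ hχ).add (d₂ θ u hu φ hφ χ hχ)⟩

/-- Controlled functions are bounded pointwise by the energy densities. -/
lemma sq_le (hS : S.IsSmall) (hF : S.IsControlled i F) :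
    ∃ C, 0 ≤ C ∧ ∀ u : ℝ → ℝ → ℝ, ∀ φ, ∀ χ ∈ Ioc 0 S.B,
      F u φ χ ^ 2 ≤ C * (S.r χ ^ 2 * ∑ l ∈ Finset.range (i + 1), S.density (pφ^[l] u) φ χ) := by
  have single : ∀ {i l : ℕ} {a : ℝ → ℝ} {X : (ℝ → ℝ → ℝ) → ℝ → ℝ → ℝ}, l ≤ i → S.IsSymbol a →
      (∀ u φ, ∀ χ ∈ Ioc 0 S.B, X u φ χ ^ 2 ≤ 20000 * (S.r χ ^ 2 * S.density (pφ^[l] u) φ χ)) →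
      ∃ C, 0 ≤ C ∧ ∀ u : ℝ → ℝ → ℝ, ∀ φ, ∀ χ ∈ Ioc 0 S.B, (a χ * X u φ χ) ^ 2
        ≤ C * (S.r χ ^ 2 * ∑ l ∈ Finset.range (i + 1), S.density (pφ^[l] u) φ χ) := by
    intro i l a X hl ha hX
    obtain ⟨K, hK⟩ := ha.bounded
    refine ⟨K ^ 2 * 20000, by positivity, fun u φ χ hχ => ?_⟩
    have h1 : S.density (pφ^[l] u) φ χ
        ≤ ∑ l ∈ Finset.range (i + 1), S.density (pφ^[l] u) φ χ :=
      Finset.single_le_sum (f := fun l => S.density (pφ^[l] u) φ χ)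
        (fun _ _ => density_nonneg) (Finset.mem_range.2 (by omega))
    have h2 : a χ ^ 2 ≤ K ^ 2 := by
      rw [← sq_abs]; exact pow_le_pow_left₀ (abs_nonneg _) (hK χ hχ) 2
    calc (a χ * X u φ χ) ^ 2 = a χ ^ 2 * X u φ χ ^ 2 := by ring
      _ ≤ K ^ 2 * (20000 * (S.r χ ^ 2 * ∑ l ∈ Finset.range (i + 1), S.density (pφ^[l] u) φ χ)) := by
          gcongr
          refine (hX u φ χ hχ).trans ?_
          gcongr
      _ = _ := by ring
  induction hF with
  | value hl ha =>
    refine single hl ha fun u φ χ hχ => ?_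
    have hr := S.r_pos χ hχ
    set v := pφ^[_] u
    have e : S.r χ ^ 2 * S.density v φ χ = v φ χ ^ 2
        + S.r χ ^ 2 * (pφ v φ χ ^ 2 + S.r χ ^ 4 * S.pχ v φ χ ^ 2) := by
      rw [density]; field_simp; ring
    have h0 : 0 ≤ S.r χ ^ 2 * (pφ v φ χ ^ 2 + S.r χ ^ 4 * S.pχ v φ χ ^ 2) := by positivity
    have h1 := sq_nonneg (v φ χ)
    rw [e]; linarith
  | @lin l _ hl ha =>
    refine single (X := fun u φ χ => S.r χ * S.lin (pφ^[_] u) φ χ) hl ha fun u φ χ hχ => ?_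
    have h1 := hS.lin_sq_le (u := pφ^[l] u) (φ := φ) hχ
    simp only [mul_pow]
    rw [mul_left_comm]
    gcongr
    refine h1.trans ?_
    rw [density]
    have := sq_nonneg (pφ (pφ^[l] u) φ χ)
    linarith
  | top ha =>
    refine single (X := fun u φ χ => S.r χ * (pφ^[_ + 1] u) φ χ) (le_refl _) ha
      fun u φ χ hχ => ?_
    simp only [mul_pow]
    rw [mul_left_comm, Function.iterate_succ_apply']
    have hr := S.r_pos χ hχ
    gcongr
    set v := pφ^[_] u
    have h0 : 0 ≤ v φ χ ^ 2 / S.r χ ^ 2 := by positivity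
    have h1 : 0 ≤ S.r χ ^ 4 * S.pχ v φ χ ^ 2 := by positivity
    have h2 := sq_nonneg (pφ v φ χ)
    rw [density]; linarith
  | add _ _ ih ih' =>
    obtain ⟨C, hC, h⟩ := ih
    obtain ⟨C', hC', h'⟩ := ih'
    refine ⟨2 * C + 2 * C', by positivity, fun u φ χ hχ => ?_⟩
    have a1 := h u φ χ hχ
    have a2 := h' u φ χ hχ
    exact add_sq_le.trans (by linarith)

/-- If `r₀^e g` is controlled, so are the weighted `χ`-derivatives of `g`. -/
lemma iterate_pχ (hS : S.IsSmall) (hF : S.IsControlled i F) (e j : ℕ) :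
    ∃ F', S.IsControlled (i + j) F' ∧ ∀ θ u, S.IsWave θ u → ∀ g : ℝ → ℝ → ℝ,
      (∀ φ, 0 ≤ φ → ∀ χ ∈ Ioc 0 S.B, S.r χ ^ e * g φ χ = F u φ χ) →
      ∀ φ, 0 ≤ φ → ∀ χ ∈ Ioc 0 S.B, S.r χ ^ (e + 3 * j) * (S.pχ^[j] g) φ χ = F' u φ χ := by
  induction j with
  | zero => exact ⟨F, hF, fun θ u hu g hg => by simpa using hg⟩
  | succ j ih =>
    obtain ⟨F₁, h₁, d₁⟩ := ih
    obtain ⟨F₂, h₂, d₂⟩ := h₁.scaled_deriv hS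
    -- The second summand compensates for the derivative of the weight: r₀³∂_χ(r₀^k) = k s r₀^k.
    refine ⟨_, h₂.add ((h₁.succ hS).smul
      ((IsSymbol.const (-((e + 3 * j : ℕ) : ℝ))).mul hS.isSymbol_s)),
      fun θ u hu g hg φ hφ χ hχ => ?_⟩
    have h3 : ∀ x ∈ Ioc 0 S.B, (S.pχ^[j] g) φ x = F₁ u φ x / S.r x ^ (e + 3 * j) :=
      fun x hx => by
        rw [← d₁ θ u hu g hg φ hφ x hx, mul_div_cancel_left₀ _ (pow_ne_zero _ (r_ne hx))]
    have hr := r_ne hχ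
    have h4 := pχ_of_hasDeriv (f := S.pχ^[j] g) (φ := φ) hχ (((d₂ θ u hu φ hφ χ hχ).div
      ((hasDerivWithinAt_r hχ).pow (e + 3 * j)) (pow_ne_zero _ hr)).congr_of_mem h3 hχ)
    rw [Function.iterate_succ_apply', h4]
    rw [show e + 3 * (j + 1) = e + 3 * j + 3 by ring]
    simp only [Pi.pow_apply]
    -- The exponent zero is separated because the derivative of a power involves truncated
    -- subtraction in the exponent.
    rcases e + 3 * j with _ | k
    · simp
      field_simp
    · push_cast
      field_simp
      ring

lemma iterate_pφ (hS : S.IsSmall) (hF : S.IsControlled i F) (e j : ℕ) :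
    ∃ F', S.IsControlled (i + j) F' ∧ ∀ θ u, S.IsWave θ u → ∀ g : ℝ → ℝ → ℝ,
      (∀ φ, 0 ≤ φ → ∀ χ ∈ Ioc 0 S.B, S.r χ ^ e * g φ χ = F u φ χ) →
      ∀ φ, 0 ≤ φ → ∀ χ ∈ Ioc 0 S.B, S.r χ ^ e * (pφ^[j] g) φ χ = F' u φ χ := by
  induction j with
  | zero => exact ⟨F, hF, fun θ u hu g hg => by simpa using hg⟩
  | succ j ih =>
    obtain ⟨F₁, h₁, d₁⟩ := ih
    obtain ⟨F₂, h₂, d₂⟩ := h₁.deriv_φ hS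
    refine ⟨F₂, h₂, fun θ u hu g hg φ hφ χ hχ => ?_⟩
    have hr : S.r χ ^ e ≠ 0 := pow_ne_zero _ (r_ne hχ)
    have h3 : ∀ t ∈ Ici (0 : ℝ), (pφ^[j] g) t χ = F₁ u t χ / S.r χ ^ e :=
      fun t ht => by
        rw [← d₁ θ u hu g hg t ht χ hχ, mul_div_cancel_left₀ _ hr]
    have h4 := pφ_of_hasDeriv (f := pφ^[j] g) hφ
      (((d₂ θ u hu φ hφ χ hχ).div_const _).congr_of_mem h3 hφ)
    rw [Function.iterate_succ_apply', h4, mul_div_cancel₀ _ hr]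

/-- Pointwise bounds for the mixed partial derivatives. -/
lemma partials_sq_le (hS : S.IsSmall) (hF : S.IsControlled 0 F) (e j₁ j₂ : ℕ)
    (hi : j₁ + j₂ ≤ i) : ∃ C, 0 ≤ C ∧ ∀ θ u, S.IsWave θ u → ∀ g : ℝ → ℝ → ℝ,
      (∀ φ, 0 ≤ φ → ∀ χ ∈ Ioc 0 S.B, S.r χ ^ e * g φ χ = F u φ χ) →
      ∀ φ, 0 ≤ φ → ∀ χ ∈ Ioc 0 S.B, (S.r χ ^ (e + 3 * j₂) * S.partials j₁ j₂ g φ χ) ^ 2 ≤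
        C * (S.r χ ^ 2 * ∑ l ∈ Finset.range (i + 1), S.density (pφ^[l] u) φ χ) := by
  obtain ⟨F₁, h₁, d₁⟩ := hF.iterate_pχ hS e j₂
  obtain ⟨F₂, h₂, d₂⟩ := h₁.iterate_pφ hS (e + 3 * j₂) j₁
  obtain ⟨C, hC, h⟩ := (h₂.of_le hS (j := i) (by omega)).sq_le hS
  refine ⟨C, hC, fun θ u hu g hg φ hφ χ hχ => ?_⟩
  rw [partials, d₂ θ u hu _ (d₁ θ u hu g hg) φ hφ χ hχ]
  exact h u φ χ hχ

end IsControlled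
end StaticHardStar

/-! ### Integration of the pointwise bounds and the proposition. -/

namespace StaticHardStar

variable {S : StaticHardStar} {φ χ θ : ℝ} {u : ℝ → ℝ → ℝ} {i : ℕ}

/-- Integration of a pointwise bound by the energy densities. -/
lemma IsWave.lintegral_le (hS : S.IsSmall) (hu : S.IsWave θ u) (h0 : 0 ≤ θ) (h1 : θ ≤ 1)
    (hφ : 0 ≤ φ) {C : ℝ} (hC : 0 ≤ C) {f : ℝ → ℝ}
    (hf : ∀ χ ∈ Ioc 0 S.B,
      f χ ≤ C * ∑ l ∈ Finset.range (i + 1), S.density (pφ^[l] u) φ χ) :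
    ∫⁻ χ in Ioc 0 S.B, ENNReal.ofReal (f χ)
      ≤ ENNReal.ofReal (C * 20000) * S.initialEnergy i u := by
  calc ∫⁻ χ in Ioc 0 S.B, ENNReal.ofReal (f χ)
      ≤ ∫⁻ χ in Ioc 0 S.B, ENNReal.ofReal C *
          ∑ l ∈ Finset.range (i + 1), ENNReal.ofReal (S.density (pφ^[l] u) φ χ) := by
        refine setLIntegral_mono' measurableSet_Ioc fun χ hχ => ?_
        rw [← ENNReal.ofReal_sum_of_nonneg fun _ _ => density_nonneg, ← ENNReal.ofReal_mul hC]
        exact ENNReal.ofReal_le_ofReal (hf χ hχ)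
    _ = ENNReal.ofReal C * ∑ l ∈ Finset.range (i + 1), S.energy (pφ^[l] u) φ := by
        rw [lintegral_const_mul' _ _ ENNReal.ofReal_ne_top, lintegral_finsetSum' _ fun l _ =>
          ((hu.pφ_iterate hS l).integrableOn_density hS hφ).aemeasurable.ennreal_ofReal]
        rfl
    _ ≤ ENNReal.ofReal C * ∑ l ∈ Finset.range (i + 1),
          ENNReal.ofReal 20000 * S.energy (pφ^[l] u) 0 := by
        gcongr with l _
        exact (hu.pφ_iterate hS l).energy_le hS h0 h1 hφ
    _ = _ := by
        rw [← Finset.mul_sum, ← mul_assoc, ← ENNReal.ofReal_mul hC, initialEnergy]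

lemma initialEnergy_lt_top (hS : S.IsSmall) (hu : S.IsWave θ u) : S.initialEnergy i u < ⊤ :=
  ENNReal.sum_lt_top.2 fun l _ => (hu.pφ_iterate hS l).energy_lt_top hS

lemma isControlled_id : S.IsControlled 0 (fun v φ χ => 1 * (pφ^[0] v) φ χ) :=
  .value le_rfl (.const 1)

lemma isControlled_lin : S.IsControlled 0 (fun v φ χ => 1 * (S.r χ * S.lin (pφ^[0] v) φ χ)) :=
  .lin le_rfl (.const 1)

lemma isControlled_omega : S.IsControlled 0 (fun v φ χ =>
    1 * (S.r χ * S.lin (pφ^[0] v) φ χ) + -2 * (pφ^[0] v) φ χ) :=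
  isControlled_lin.add (.value le_rfl (.const (-2)))

lemma mem_orders {j : ℕ × ℕ} (hj : j ∈ orders i) : j.1 + j.2 ≤ i := by
  simpa using (Finset.mem_filter.1 hj).2

/-- The factor r₀² in the bound for controlled quantities is divided out, which accounts for the
exponent -2 in the weight. -/
lemma radius_term_le (hS : S.IsSmall) (j : ℕ × ℕ) (hj : j.1 + j.2 ≤ i) :
    ∃ C, 0 ≤ C ∧ ∀ θ u, S.IsWave θ u → ∀ φ, 0 ≤ φ → ∀ χ ∈ Ioc 0 S.B,
      S.r χ ^ (6 * (j.2 : ℤ) - 2) * S.partials j.1 j.2 u φ χ ^ 2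
        ≤ C * ∑ l ∈ Finset.range (i + 1), S.density (pφ^[l] u) φ χ := by
  obtain ⟨C, hC, h⟩ := isControlled_id.partials_sq_le hS 0 j.1 j.2 hj
  refine ⟨C, hC, fun θ u hu φ hφ χ hχ => ?_⟩
  have h1 := h θ u hu u (fun φ _ χ _ => by simp) φ hφ χ hχ
  have hr := S.r_pos χ hχ
  have e : S.r χ ^ (6 * (j.2 : ℤ) - 2) = S.r χ ^ (6 * j.2) / S.r χ ^ 2 := by
    rw [zpow_sub₀ hr.ne']; norm_cast
  rw [e, div_mul_eq_mul_div, div_le_iff₀ (by positivity)]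
  calc S.r χ ^ (6 * j.2) * S.partials j.1 j.2 u φ χ ^ 2
      = (S.r χ ^ (0 + 3 * j.2) * S.partials j.1 j.2 u φ χ) ^ 2 := by ring
    _ ≤ _ := h1.trans_eq (by ring)

/-- Only r₀ψ₁ and r₀ω₁ are controlled, so the factor r₀² is spent on this extra r₀ and the weight
has no negative shift. -/
lemma metric_term_le (hS : S.IsSmall) {F : (ℝ → ℝ → ℝ) → ℝ → ℝ → ℝ} (hF : S.IsControlled 0 F)
    (j : ℕ × ℕ) (hj : j.1 + j.2 ≤ i) :
    ∃ C, 0 ≤ C ∧ ∀ θ u, S.IsWave θ u → ∀ g : ℝ → ℝ → ℝ,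
      (∀ φ, 0 ≤ φ → ∀ χ ∈ Ioc 0 S.B, S.r χ ^ 1 * g φ χ = F u φ χ) →
      ∀ φ, 0 ≤ φ → ∀ χ ∈ Ioc 0 S.B,
      S.r χ ^ (6 * j.2) * S.partials j.1 j.2 g φ χ ^ 2
        ≤ C * ∑ l ∈ Finset.range (i + 1), S.density (pφ^[l] u) φ χ := by
  obtain ⟨C, hC, h⟩ := hF.partials_sq_le hS 1 j.1 j.2 hj
  refine ⟨C, hC, fun θ u hu g hg φ hφ χ hχ => ?_⟩
  have h1 := h θ u hu g hg φ hφ χ hχ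
  have hr := S.r_pos χ hχ
  refine le_of_mul_le_mul_left ?_ (pow_pos hr 2)
  calc S.r χ ^ 2 * (S.r χ ^ (6 * j.2) * S.partials j.1 j.2 g φ χ ^ 2)
      = (S.r χ ^ (1 + 3 * j.2) * S.partials j.1 j.2 g φ χ) ^ 2 := by ring
    _ ≤ _ := h1.trans_eq (by ring)

lemma radiusEnergy_le (hS : S.IsSmall) (i : ℕ) :
    ∃ C, 0 ≤ C ∧ ∀ θ u, 0 ≤ θ → θ ≤ 1 → S.IsWave θ u → ∀ φ, 0 ≤ φ →
      S.radiusEnergy i u φ ≤ ENNReal.ofReal C * S.initialEnergy i u := by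
  choose! C hC h using fun j (hj : j ∈ orders i) => radius_term_le hS j (mem_orders hj)
  have hC' : 0 ≤ ∑ j ∈ orders i, C j := Finset.sum_nonneg hC
  refine ⟨(∑ j ∈ orders i, C j) * 20000, by positivity, fun θ u h0 h1 hu φ hφ => ?_⟩
  refine hu.lintegral_le hS h0 h1 hφ hC' fun χ hχ => ?_
  rw [Finset.sum_mul]
  exact Finset.sum_le_sum fun j hj => h j hj θ u hu φ hφ χ hχ

lemma metricEnergy_le (hS : S.IsSmall) (i : ℕ) :
    ∃ C, 0 ≤ C ∧ ∀ θ u, 0 ≤ θ → θ ≤ 1 → S.IsWave θ u → ∀ ψ w : ℝ → ℝ → ℝ,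
      (∀ φ, 0 ≤ φ → ∀ χ ∈ Ioc 0 S.B, ψ φ χ = S.lin u φ χ) →
      (∀ φ, 0 ≤ φ → ∀ χ ∈ Ioc 0 S.B, w φ χ = S.lin u φ χ - 2 / S.r χ * u φ χ) →
      ∀ φ, 0 ≤ φ → S.metricEnergy i ψ w φ ≤ ENNReal.ofReal C * S.initialEnergy i u := by
  choose! C hC h using fun j (hj : j ∈ orders i) =>
    metric_term_le hS isControlled_lin j (mem_orders hj)
  choose! C' hC' h' using fun j (hj : j ∈ orders i) =>
    metric_term_le hS isControlled_omega j (mem_orders hj)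
  have hCC : 0 ≤ ∑ j ∈ orders i, (C j + C' j) :=
    Finset.sum_nonneg fun j hj => add_nonneg (hC j hj) (hC' j hj)
  refine ⟨(∑ j ∈ orders i, (C j + C' j)) * 20000, by positivity,
    fun θ u h0 h1 hu ψ w hψ hw φ hφ => ?_⟩
  refine hu.lintegral_le hS h0 h1 hφ hCC fun χ hχ => ?_
  rw [Finset.sum_mul]
  refine Finset.sum_le_sum fun j hj => ?_
  rw [mul_add, add_mul]
  refine add_le_add (h j hj θ u hu ψ (fun φ hφ χ hχ => ?_) φ hφ χ hχ)
    (h' j hj θ u hu w (fun φ hφ χ hχ => ?_) φ hφ χ hχ)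
  · rw [hψ φ hφ χ hχ]; simp
  · have := r_ne hχ
    rw [hw φ hφ χ hχ]
    simp only [Function.iterate_zero, id_eq]
    field_simp
    ring

end StaticHardStar

end

theorem proposition4p3 :
    ∃ ε : ℝ, 0 < ε ∧ ∀ S : StaticHardStar, S.radius < ε → S.rho 0 < 1 + ε →
      ∃ C : ℕ → ℝ, (∀ i, 0 < C i) ∧ StrictMono C ∧
        ∀ r₁ rho₁ n₁ psi₁ omega₁ m₁ : ℝ → ℝ → ℝ,
          S.IsLinearisedSolution r₁ rho₁ n₁ psi₁ omega₁ m₁ →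
          ∀ i : ℕ, 1 ≤ i →
            S.initialEnergy i r₁ < ⊤ ∧
            ∀ φ : ℝ, 0 ≤ φ →
              S.radiusEnergy i r₁ φ ≤ ENNReal.ofReal (C i) * S.initialEnergy i r₁ ∧
              S.metricEnergy i psi₁ omega₁ φ ≤ ENNReal.ofReal (C i) * S.initialEnergy i r₁ := by
  refine ⟨1 / 100, by norm_num, fun S h₁ h₂ => ?_⟩
  have hS : S.IsSmall := ⟨h₁, h₂⟩
  choose C hC hr using fun i => StaticHardStar.radiusEnergy_le hS i
  choose C' hC' hm using fun i => StaticHardStar.metricEnergy_le hS i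
  have hpos : ∀ i, 0 < C i + C' i + 1 := fun i => by linarith [hC i, hC' i]
  have hle : ∀ i, C i + C' i + 1 ≤ ∑ k ∈ Finset.range (i + 1), (C k + C' k + 1) := fun i =>
    Finset.single_le_sum (f := fun k => C k + C' k + 1) (fun k _ => (hpos k).le)
      (Finset.self_mem_range_succ i)
  -- Partial sums with an added 1 make the constants positive and strictly increasing while
  -- dominating both families.
  refine ⟨fun i => ∑ k ∈ Finset.range (i + 1), (C k + C' k + 1),
    fun i => (hpos i).trans_le (hle i), strictMono_nat_of_lt_succ fun i => ?_,
    fun r₁ rho₁ n₁ psi₁ omega₁ m₁ h i _ => ?_⟩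
  · rw [Finset.sum_range_succ _ (i + 1)]
    linarith [hpos (i + 1)]
  · obtain ⟨θ, h0, h1, hu⟩ := h.isWave hS
    refine ⟨StaticHardStar.initialEnergy_lt_top hS hu, fun φ hφ => ⟨?_, ?_⟩⟩
    · refine (hr i θ r₁ h0 h1 hu φ hφ).trans ?_
      gcongr
      linarith [hle i, hC' i]
    · refine (hm i θ r₁ h0 h1 hu psi₁ omega₁ (fun φ hφ χ hχ => ?_) (fun φ hφ χ hχ => ?_)
        φ hφ).trans ?_
      · have := StaticHardStar.r_ne hχ
        have := (StaticHardStar.s_pos hχ).ne'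
        rw [h.psi_eq φ hφ χ hχ, StaticHardStar.dχ_r hχ, StaticHardStar.lin, StaticHardStar.p]
        field_simp
        ring
      · have := StaticHardStar.r_ne hχ
        have := (StaticHardStar.s_pos hχ).ne'
        rw [h.omega_eq φ hφ χ hχ, StaticHardStar.dχ_r hχ, StaticHardStar.lin, StaticHardStar.p]
        field_simp
        ring
      · gcongr
        linarith [hle i, hC i]
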